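/- Identify the algebra $\mathbb H_{\mathbb C}=\mathbb C\otimes\mathbb H$ of complexified quaternions with the complex $2\times 2$ matrices $Z=\begin{pmatrix} z_{11}&z_{12}\\ z_{21}&z_{22}\end{pmatrix}$, in such a way that the real quaternion $X=x^0+x^1e_1+x^2e_2+x^3e_3\in\mathbb H$ becomes $\begin{pmatrix} x^0-ix^3 & -ix^1-x^2\\ -ix^1+x^2 & x^0+ix^3\end{pmatrix}$. Put $N(Z)=\det Z$ (so that $N(X)=\sum_k (x^k)^2$ for $X\in\mathbb H$), $Z^+=\begin{pmatrix} z_{22}&-z_{12}\\ -z_{21}&z_{11}\end{pmatrix}$, $\partial_{ij}=\partial/\partial z_{ij}$, $$\nabla=2\begin{pmatrix}\partial_{11}&\partial_{21}\\ \partial_{12}&\partial_{22}\end{pmatrix},\qquad \square=4(\partial_{11}\partial_{22}-\partial_{12}\partial_{21}),\qquad \operatorname{Mx}F=\nabla F\nabla-\square F^+,$$ where $\nabla$ acts on a matrix-valued function from the left and from the right by matrix multiplication. For $R>0$ let $U(2)_R=\{RZ : Z\in U(2)\}$, oriented by the left translates $Z\tilde e_0, Ze_1,Ze_2,Ze_3$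 of the basis $$\tilde e_0=\begin{pmatrix}-i&0\\0&-i\end{pmatrix},\quad e_1=\begin{pmatrix}0&-i\\-i&0\end{pmatrix},\quad e_2=\begin{pmatrix}0&-1\\1&0\end{pmatrix},\quad e_3=\begin{pmatrix}-i&0\\0&i\end{pmatrix}$$ of the tangent space of $U(2)$ at $1$, and let $dZ^4=dz_{11}\wedge dz_{12}\wedge dz_{21}\wedge dz_{22}$. Theorem. Let $F\in\mathbb H_{\mathbb C}[z_{ij}]$ be an $\mathbb H_{\mathbb C}$-valued polynomial function on $\mathbb H_{\mathbb C}$, let $R>0$, and let $W\in\mathbb H$ with $N(W)<R^2$. Then $N(Z-W)\neq 0$ for all $Z\in U(2)_R$, and $$\operatorname{Mx}F(W)=\frac{3i}{\pi^3}\int_{Z\in U(2)_R}\frac{(Z-W)^{-1}}{N(Z-W)}\cdot F(Z)\cdot\frac{(Z-W)^{-1}}{N(Z-W)}\,dZ^4 .$$ -/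

import Mathlib

/-- The algebra `ℍ_ℂ = ℂ ⊗ ℍ` of complexified quaternions, realized as complex `2 × 2` matrices.
The matrix entry `z_{ij}` is `Z (i-1) (j-1)`. -/
abbrev HC : Type := Matrix (Fin 2) (Fin 2) ℂ

namespace HC

/-- The inclusion `ℍ ⊂ ℍ_ℂ`:
`x⁰ + x¹ e₁ + x² e₂ + x³ e₃ ↦ (x⁰ - i x³, -i x¹ - x² ; -i x¹ + x², x⁰ + i x³)`. -/
noncomputable def ofQuaternion (X : Quaternion ℝ) : HC :=
  !![(X.re : ℂ) - Complex.I * X.imK, -Complex.I * X.imI - X.imJ;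
     -Complex.I * X.imI + X.imJ, (X.re : ℂ) + Complex.I * X.imK]

/-- The quadratic form `N(Z) = det Z`. -/
noncomputable def N (Z : HC) : ℂ := Z.det

/-- Quaternionic conjugation `Z⁺`. -/
def conj (Z : HC) : HC := !![Z 1 1, -Z 0 1; -Z 1 0, Z 0 0]

theorem N_ofQuaternion (X : Quaternion ℝ) :
    N (ofQuaternion X) = (Quaternion.normSq X : ℝ) := by
  simp only [N, ofQuaternion, Matrix.det_fin_two_of, Quaternion.normSq_def']
  push_cast
  linear_combination (-(X.imK : ℂ) ^ 2 - (X.imI : ℂ) ^ 2) * Complex.I_sq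

/-! ### Polynomial functions and differential operators -/

/-- The function `ℍ_ℂ → ℍ_ℂ` given by an element of `ℍ_ℂ[z_{ij}]`, i.e. by a `2 × 2` matrix of
polynomials in the four variables `z_{ij}`. -/
noncomputable def polyFun (F : Matrix (Fin 2) (Fin 2) (MvPolynomial (Fin 2 × Fin 2) ℂ))
    (Z : HC) : HC :=
  Matrix.of fun a b => MvPolynomial.eval (fun p : Fin 2 × Fin 2 => Z p.1 p.2) (F a b)

/-- The complex partial derivative `∂f/∂z_{ij}`. -/
noncomputable def pd (i j : Fin 2) (f : HC → ℂ) (Z : HC) : ℂ :=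
  deriv (fun t : ℂ => f (Z + t • Matrix.single i j (1 : ℂ))) 0

/-- `∇F` with `∇ = 2 (∂₁₁, ∂₂₁ ; ∂₁₂, ∂₂₂)`, the entries of the operator matrix acting on those
of `F` in the matrix product. The entry `(a, c)` of `∇` is `2 ∂_{ca}`. -/
noncomputable def nablaLeft (F : HC → HC) (Z : HC) : HC :=
  Matrix.of fun a b => ∑ c, 2 * pd c a (fun Y => F Y c b) Z

/-- `F∇`: the same operator matrix, multiplied from the right. -/
noncomputable def nablaRight (F : HC → HC) (Z : HC) : HC :=
  Matrix.of fun a b => ∑ c, 2 * pd b c (fun Y => F Y a c) Z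

/-- `□ = 4 (∂₁₁ ∂₂₂ - ∂₁₂ ∂₂₁)`, entry by entry. -/
noncomputable def box (F : HC → HC) (Z : HC) : HC :=
  Matrix.of fun a b =>
    4 * (pd 0 0 (pd 1 1 fun Y => F Y a b) Z - pd 0 1 (pd 1 0 fun Y => F Y a b) Z)

/-- `Mx F = ∇F∇ - □F⁺`. -/
noncomputable def Mx (F : HC → HC) (Z : HC) : HC :=
  nablaRight (nablaLeft F) Z - box (fun Y => conj (F Y)) Z

/-- The Fueter kernel `Z⁻¹ / N(Z)`. -/
noncomputable def fueterKernel (Z : HC) : HC := (N Z)⁻¹ • Z⁻¹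

/-! ### The cycle `U(2)_R` and integration of 4-forms -/

/-- The holomorphic 4-form `dZ⁴ = dz₁₁ ∧ dz₁₂ ∧ dz₂₁ ∧ dz₂₂` evaluated on four vectors. -/
noncomputable def dZ4 (v : Fin 4 → HC) : ℂ :=
  Matrix.det (Matrix.of fun r c : Fin 4 => ![v c 0 0, v c 0 1, v c 1 0, v c 1 1] r)

/-- The `k`-th partial derivative of a map of four real variables into `ℍ_ℂ`. -/
noncomputable def cubePartial (φ : (Fin 4 → ℝ) → HC) (k : Fin 4) (u : Fin 4 → ℝ) : HC :=
  Matrix.of fun a b => deriv (fun s : ℝ => φ (Function.update u k s) a b) (u k)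

/-- The integral of the `ℍ_ℂ`-valued 4-form `G(Z) dZ⁴` over the smooth singular cube
`φ : ∏ₖ [0, Lₖ] → ℍ_ℂ`, i.e. the integral over the box of the pulled back form. -/
noncomputable def cubeIntegral (φ : (Fin 4 → ℝ) → HC) (L : Fin 4 → ℝ) (G : HC → HC) : HC :=
  Matrix.of fun a b =>
    ∫ u in Set.Icc (0 : Fin 4 → ℝ) L, G (φ u) a b * dZ4 (fun k => cubePartial φ k u)

/-- `U(2)_R = {R Z ; Z ∈ U(2)}`. -/
def U2R (R : ℝ) : Set HC := {Z | ∃ U ∈ Matrix.unitaryGroup (Fin 2) ℂ, Z = (R : ℂ) • U}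

/-- The parametrization of `U(2)_R` by
`(t, α, η, β) ↦ R e^{-it} (cos η e^{iα}, sin η e^{iβ} ; -sin η e^{-iβ}, cos η e^{-iα})`. -/
noncomputable def u2Cube (R : ℝ) (u : Fin 4 → ℝ) : HC :=
  ((R : ℂ) * Complex.exp (-(u 0 * Complex.I))) •
    !![Real.cos (u 2) * Complex.exp (u 1 * Complex.I),
        Real.sin (u 2) * Complex.exp (u 3 * Complex.I);
       -(Real.sin (u 2) * Complex.exp (-(u 3 * Complex.I))),
        Real.cos (u 2) * Complex.exp (-(u 1 * Complex.I))]

/-- The ranges `t ∈ [0, π]`, `α ∈ [0, 2π]`, `η ∈ [0, π/2]`, `β ∈ [0, 2π]`. -/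
noncomputable def u2Box : Fin 4 → ℝ := ![Real.pi, 2 * Real.pi, Real.pi / 2, 2 * Real.pi]

/-- `∫_{Z ∈ U(2)_R} G(Z) dZ⁴`, where `U(2)_R` carries the orientation induced from the positively
oriented basis `ẽ₀, e₁, e₂, e₃` of the tangent space `𝕄` of `U(2)` at `1`. The parametrization
`u2Cube R` is onto `U(2)_R`, injective in the interior of the box, and orientation preserving
there: see `u2Cube_image`, `u2Cube_injOn`, `u2Cube_oriented`. -/
noncomputable def integralU2R (R : ℝ) (G : HC → HC) : HC := cubeIntegral (u2Cube R) u2Box G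

/-- The basis `ẽ₀ = -i e₀, e₁, e₂, e₃` of the Minkowski space `𝕄 = {Z ; Z* = -Z}`. -/
noncomputable def minkowskiBasis : Fin 4 → HC :=
  ![!![-Complex.I, 0; 0, -Complex.I], !![0, -Complex.I; -Complex.I, 0],
    !![0, -1; 1, 0], !![-Complex.I, 0; 0, Complex.I]]

/-- Polar form with the angle in `[0, 2π]`. -/
theorem exists_angle (z : ℂ) :
    ∃ θ : ℝ, 0 ≤ θ ∧ θ ≤ 2 * Real.pi ∧ z = ‖z‖ * Complex.exp (θ * Complex.I) := by
  have h := Complex.norm_mul_exp_arg_mul_I z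
  have h1 := Complex.neg_pi_lt_arg z
  have h2 := Complex.arg_le_pi z
  have hpi := Real.pi_pos
  by_cases h0 : 0 ≤ z.arg
  · exact ⟨z.arg, h0, by linarith, h.symm⟩
  · refine ⟨z.arg + 2 * Real.pi, by linarith, by linarith, ?_⟩
    push_cast
    rw [add_mul, Complex.exp_add, Complex.exp_two_pi_mul_I, mul_one]
    exact h.symm

theorem exp_angle_inj {x y : ℝ} (hx : 0 < x ∧ x < 2 * Real.pi) (hy : 0 < y ∧ y < 2 * Real.pi)
    (h : Complex.exp (x * Complex.I) = Complex.exp (y * Complex.I)) : x = y := by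
  obtain ⟨n, hn⟩ := Complex.exp_eq_exp_iff_exists_int.1 h
  have hn' : x = y + n * (2 * Real.pi) := by
    have := congrArg Complex.im hn
    simpa using this
  have hpi := Real.pi_pos
  have h1 : n < 1 := by
    by_contra hc
    have : (1 : ℝ) ≤ n := by exact_mod_cast not_lt.1 hc
    nlinarith
  have h2 : -1 < n := by
    by_contra hc
    have : (n : ℝ) ≤ -1 := by exact_mod_cast not_lt.1 hc
    nlinarith
  have h3 : n = 0 := by omega
  simpa [h3] using hn'

theorem conj_exp_mul_I (x : ℝ) :
    (starRingEnd ℂ) (Complex.exp (x * Complex.I)) = Complex.exp (-(x * Complex.I)) := by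
  rw [← Complex.exp_conj]; simp

theorem exp_mul_exp_neg (z : ℂ) : Complex.exp z * Complex.exp (-z) = 1 := by
  rw [← Complex.exp_add]; simp

theorem u2Cube_image {R : ℝ} : u2Cube R '' Set.Icc 0 u2Box = U2R R := by
  apply Set.Subset.antisymm
  · rintro _ ⟨u, -, rfl⟩
    refine ⟨u2Cube 1 u, ?_, by simp only [u2Cube, smul_smul, Complex.ofReal_one, one_mul]⟩
    rw [Matrix.mem_unitaryGroup_iff]
    have h0 := exp_mul_exp_neg (u 0 * Complex.I)
    have h1 := exp_mul_exp_neg (u 1 * Complex.I)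
    have h3 := exp_mul_exp_neg (u 3 * Complex.I)
    have hcs : (Real.sin (u 2) : ℂ) ^ 2 + (Real.cos (u 2) : ℂ) ^ 2 = 1 := by
      exact_mod_cast Real.sin_sq_add_cos_sq (u 2)
    have c0 : (starRingEnd ℂ) (Complex.exp (-(u 0 * Complex.I))) = Complex.exp (u 0 * Complex.I) := by
      rw [← conj_exp_mul_I, Complex.conj_conj]
    have c1 : (starRingEnd ℂ) (Complex.exp (-(u 1 * Complex.I))) = Complex.exp (u 1 * Complex.I) := by
      rw [← conj_exp_mul_I, Complex.conj_conj]
    have c3 : (starRingEnd ℂ) (Complex.exp (-(u 3 * Complex.I))) = Complex.exp (u 3 * Complex.I) := by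
      rw [← conj_exp_mul_I, Complex.conj_conj]
    ext a b
    fin_cases a <;> fin_cases b <;>
      simp only [u2Cube, Matrix.mul_apply, Fin.sum_univ_two, Matrix.star_apply, Matrix.smul_apply,
        smul_eq_mul, RCLike.star_def, map_mul, map_neg, Complex.conj_ofReal, conj_exp_mul_I,
        c0, c1, c3, Matrix.of_apply, Matrix.cons_val', Matrix.cons_val_zero, Matrix.cons_val_one,
        Fin.zero_eta, Fin.mk_one, Fin.isValue, Matrix.one_apply, Complex.ofReal_one, one_mul,
        zero_ne_one, one_ne_zero, if_true, if_false, Matrix.cons_val_fin_one] <;>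
      generalize Complex.exp (u 0 * Complex.I) = x0 at * <;>
      generalize Complex.exp (-(u 0 * Complex.I)) = y0 at * <;>
      generalize Complex.exp (u 1 * Complex.I) = x1 at * <;>
      generalize Complex.exp (-(u 1 * Complex.I)) = y1 at * <;>
      generalize Complex.exp (u 3 * Complex.I) = x3 at * <;>
      generalize Complex.exp (-(u 3 * Complex.I)) = y3 at * <;>
      generalize (Real.sin (u 2) : ℂ) = s at * <;>
      generalize (Real.cos (u 2) : ℂ) = c at * <;>
      grind
  · rintro _ ⟨U, hU, rfl⟩
    have hdet : ‖U.det‖ = 1 := by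
      have := Matrix.det_of_mem_unitary hU
      exact CStarRing.norm_of_mem_unitary this
    obtain ⟨θ, hθ0, hθ1, hθ⟩ := exists_angle (star U.det)
    rw [norm_star, hdet] at hθ
    set t : ℝ := θ / 2 with ht
    set w := Complex.exp (t * Complex.I) with hw
    set w' := Complex.exp (-(t * Complex.I)) with hw'
    have hww : w * w' = 1 := exp_mul_exp_neg _
    have hθ2 : star U.det = w ^ 2 := by
      rw [hθ, hw, ← Complex.exp_nat_mul]
      simp only [ht]; push_cast; rw [one_mul]; congr 1; ring
    have hd1 : star U.det * U.det = 1 := by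
      have := Matrix.det_of_mem_unitary hU
      exact (Unitary.mem_iff.1 this).1
    have hdw : U.det = w' ^ 2 := by
      rw [hθ2] at hd1
      linear_combination w' ^ 2 * hd1 - U.det * (w * w' + 1) * hww
    have hUU : star U * U = 1 := (Matrix.mem_unitaryGroup_iff').1 hU
    have hUU' : U * star U = 1 := (Matrix.mem_unitaryGroup_iff).1 hU
    -- the adjugate of `U` is `det U` times its adjoint
    have hadj : U.adjugate = U.det • star U := by
      calc U.adjugate = U.adjugate * (U * star U) := by rw [hUU', mul_one]
        _ = (U.adjugate * U) * star U := by rw [mul_assoc]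
        _ = U.det • star U := by rw [Matrix.adjugate_mul]; simp
    have e11 : U 1 1 = U.det * star (U 0 0) := by
      have := congrFun (congrFun hadj 0) 0
      simpa [Matrix.adjugate_fin_two, Matrix.star_apply] using this
    have e10 : -U 1 0 = U.det * star (U 0 1) := by
      have := congrFun (congrFun hadj 1) 0
      simpa [Matrix.adjugate_fin_two, Matrix.star_apply] using this
    have hnorm : ‖U 0 0‖ ^ 2 + ‖U 0 1‖ ^ 2 = 1 := by
      have := congrFun (congrFun hUU' 0) 0
      simp only [Matrix.mul_apply, Fin.sum_univ_two, Matrix.star_apply, Matrix.one_apply_eq,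
        RCLike.star_def, Complex.mul_conj'] at this
      exact_mod_cast this
    have hnw : ‖w‖ = 1 := Complex.norm_exp_ofReal_mul_I t
    obtain ⟨α, hα0, hα1, hα⟩ := exists_angle (w * U 0 0)
    obtain ⟨β, hβ0, hβ1, hβ⟩ := exists_angle (w * U 0 1)
    rw [norm_mul, hnw, one_mul] at hα hβ
    set η := Real.arccos ‖U 0 0‖ with hη
    have hn0 := norm_nonneg (U 0 0)
    have hn1 := norm_nonneg (U 0 1)
    have hle : ‖U 0 0‖ ≤ 1 := by nlinarith [sq_nonneg ‖U 0 1‖]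
    have hcos : Real.cos η = ‖U 0 0‖ := Real.cos_arccos (by linarith) hle
    have hsin : Real.sin η = ‖U 0 1‖ := by
      rw [hη, Real.sin_arccos, ← hnorm, add_sub_cancel_left, Real.sqrt_sq hn1]
    have hη0 : 0 ≤ η := Real.arccos_nonneg _
    have hη1 : η ≤ Real.pi / 2 := Real.arccos_le_pi_div_two.2 hn0
    refine ⟨![t, α, η, β], ?_, ?_⟩
    · constructor <;> intro k <;> fin_cases k <;> simp [u2Box] <;> linarith
    · have cw : star w = w' := conj_exp_mul_I t
      have h00 : U 0 0 = w' * (‖U 0 0‖ * Complex.exp (α * Complex.I)) := by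
        rw [← hα]; linear_combination -(U 0 0) * hww
      have h01 : U 0 1 = w' * (‖U 0 1‖ * Complex.exp (β * Complex.I)) := by
        rw [← hβ]; linear_combination -(U 0 1) * hww
      have h11 : U 1 1 = w' * (‖U 0 0‖ * Complex.exp (-(α * Complex.I))) := by
        have : star (w * U 0 0) = ‖U 0 0‖ * Complex.exp (-(α * Complex.I)) := by
          rw [hα, ← conj_exp_mul_I]; simp
        rw [← this, e11, hdw, star_mul', cw]; ring
      have h10 : U 1 0 = w' * -(‖U 0 1‖ * Complex.exp (-(β * Complex.I))) := by
        have : star (w * U 0 1) = ‖U 0 1‖ * Complex.exp (-(β * Complex.I)) := by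
          rw [hβ, ← conj_exp_mul_I]; simp
        rw [← this, ← neg_neg (U 1 0), e10, hdw, star_mul', cw]; ring
      have hU2 : U = w' • !![(‖U 0 0‖ * Complex.exp (α * Complex.I) : ℂ),
          ‖U 0 1‖ * Complex.exp (β * Complex.I);
          -(‖U 0 1‖ * Complex.exp (-(β * Complex.I))),
          ‖U 0 0‖ * Complex.exp (-(α * Complex.I))] := by
        ext a b
        fin_cases a <;> fin_cases b <;> simp <;> first | assumption | (rw [h10]; ring)
      have hv : u2Cube R ![t, α, η, β] = ((R : ℂ) * w') •
          !![(‖U 0 0‖ * Complex.exp (α * Complex.I) : ℂ),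
          ‖U 0 1‖ * Complex.exp (β * Complex.I);
          -(‖U 0 1‖ * Complex.exp (-(β * Complex.I))),
          ‖U 0 0‖ * Complex.exp (-(α * Complex.I))] := by
        rw [← hcos, ← hsin]; rfl
      rw [hv, mul_smul, ← hU2]

theorem u2Cube_injOn {R : ℝ} (hR : 0 < R) :
    Set.InjOn (u2Cube R) {u | ∀ k, 0 < u k ∧ u k < u2Box k} := by
  intro u hu v hv h
  have hR' : (R : ℂ) ≠ 0 := by exact_mod_cast hR.ne'
  have hdet : ∀ u : Fin 4 → ℝ,
      (u2Cube R u).det = R ^ 2 * Complex.exp (-((2 * u 0 : ℝ) * Complex.I)) := by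
    intro u
    have h1 := exp_mul_exp_neg (u 1 * Complex.I)
    have h3 := exp_mul_exp_neg (u 3 * Complex.I)
    have hcs : (Real.sin (u 2) : ℂ) ^ 2 + (Real.cos (u 2) : ℂ) ^ 2 = 1 := by
      exact_mod_cast Real.sin_sq_add_cos_sq (u 2)
    have h2 : Complex.exp (-((2 * u 0 : ℝ) * Complex.I))
        = Complex.exp (-(u 0 * Complex.I)) ^ 2 := by
      rw [← Complex.exp_nat_mul]; push_cast; congr 1; ring
    rw [h2, u2Cube, Matrix.det_smul, Matrix.det_fin_two_of, Fintype.card_fin]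
    linear_combination ((R : ℂ) * Complex.exp (-(u 0 * Complex.I))) ^ 2 *
      (Real.cos (u 2) ^ 2 * h1 + Real.sin (u 2) ^ 2 * h3 + hcs)
  have b0 : ∀ u : Fin 4 → ℝ, (∀ k, 0 < u k ∧ u k < u2Box k) →
      (0 < u 0 ∧ u 0 < Real.pi) ∧ (0 < u 1 ∧ u 1 < 2 * Real.pi) ∧
      (0 < u 2 ∧ u 2 < Real.pi / 2) ∧ (0 < u 3 ∧ u 3 < 2 * Real.pi) :=
    fun u hu => ⟨hu 0, hu 1, hu 2, hu 3⟩
  obtain ⟨⟨a1, a2⟩, ha1, ⟨a3, a4⟩, ha3⟩ := b0 u hu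
  obtain ⟨⟨c1, c2⟩, hc1, ⟨c3, c4⟩, hc3⟩ := b0 v hv
  have k0 : u 0 = v 0 := by
    have := congrArg Matrix.det h
    rw [hdet, hdet] at this
    have := mul_left_cancel₀ (pow_ne_zero 2 hR') this
    rw [Complex.exp_neg, Complex.exp_neg, inv_inj] at this
    have := exp_angle_inj (x := 2 * u 0) (y := 2 * v 0) ⟨by linarith, by linarith⟩
      ⟨by linarith, by linarith⟩ this
    linarith
  simp only [u2Cube, k0] at h
  have hne : (R : ℂ) * Complex.exp (-(v 0 * Complex.I)) ≠ 0 :=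
    mul_ne_zero hR' (Complex.exp_ne_zero _)
  have h' := smul_right_injective _ hne h
  have e0 := congrFun (congrFun h' 0) 0
  have e1 := congrFun (congrFun h' 0) 1
  simp only [Matrix.of_apply, Matrix.cons_val', Matrix.cons_val_zero, Matrix.cons_val_one,
    Matrix.cons_val_fin_one, Fin.isValue] at e0 e1
  have p1 : 0 < Real.cos (u 2) := Real.cos_pos_of_mem_Ioo ⟨by linarith, a4⟩
  have p2 : 0 < Real.cos (v 2) := Real.cos_pos_of_mem_Ioo ⟨by linarith, c4⟩
  have p3 : 0 < Real.sin (u 2) := Real.sin_pos_of_pos_of_lt_pi a3 (by linarith)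
  have kc : Real.cos (u 2) = Real.cos (v 2) := by
    have := congrArg norm e0
    simpa only [norm_mul, Complex.norm_exp_ofReal_mul_I, mul_one, Complex.norm_real,
      Real.norm_eq_abs, abs_of_pos p1, abs_of_pos p2] using this
  have k2 : u 2 = v 2 :=
    Real.injOn_cos ⟨a3.le, by linarith⟩ ⟨c3.le, by linarith⟩ kc
  rw [k2] at p1 p3
  rw [k2] at e0 e1
  have k1 := exp_angle_inj ha1 hc1 (mul_left_cancel₀ (by exact_mod_cast p1.ne') e0)
  have k3 := exp_angle_inj ha3 hc3 (mul_left_cancel₀ (by exact_mod_cast p3.ne') e1)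
  funext k
  fin_cases k <;> assumption

set_option maxHeartbeats 1600000 in
/-- In the interior of the box, the coordinate frame of `u2Cube R` at `Z` is positively oriented
with respect to the left translate `Z ẽ₀, Z e₁, Z e₂, Z e₃` of the positive basis of `𝕄`. -/
theorem u2Cube_oriented (R : ℝ) {u : Fin 4 → ℝ} (hu : ∀ k, 0 < u k ∧ u k < u2Box k) :
    ∃ C : Matrix (Fin 4) (Fin 4) ℝ, 0 < C.det ∧
      ∀ k, cubePartial (u2Cube R) k u =
        ∑ l, (C k l : ℂ) • (u2Cube R u * minkowskiBasis l) := by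
  have a3 : 0 < u 2 := (hu 2).1
  have a4 : u 2 < Real.pi / 2 := (hu 2).2
  have p1 : 0 < Real.cos (u 2) := Real.cos_pos_of_mem_Ioo ⟨by linarith, a4⟩
  have p3 : 0 < Real.sin (u 2) := Real.sin_pos_of_pos_of_lt_pi a3 (by linarith)
  set c := Real.cos (u 2) with hc
  set s := Real.sin (u 2) with hs
  set p := Real.cos (u 3 - u 1) with hp
  set q := Real.sin (u 3 - u 1) with hq
  have hpq : q ^ 2 + p ^ 2 = 1 := Real.sin_sq_add_cos_sq _
  have hcs : s ^ 2 + c ^ 2 = 1 := Real.sin_sq_add_cos_sq _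
  refine ⟨!![1, 0, 0, 0; 0, -(c * s * p), c * s * q, -c ^ 2; 0, -q, -p, 0;
    0, -(c * s * p), c * s * q, s ^ 2], ?_, ?_⟩
  · have : Matrix.det !![1, 0, 0, 0; 0, -(c * s * p), c * s * q, -c ^ 2; 0, -q, -p, 0;
        0, -(c * s * p), c * s * q, s ^ 2] = c * s := by
      simp [Matrix.det_succ_row_zero, Fin.sum_univ_succ, Fin.succAbove]
      linear_combination (c * s * (s ^ 2 + c ^ 2)) * hpq + c * s * hcs
    rw [this]; positivity
  · have hE : ∀ x : ℝ, HasDerivAt (fun r : ℝ => Complex.exp (r * Complex.I))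
        (Complex.exp (x * Complex.I) * Complex.I) x := fun x => by
      simpa using ((Complex.ofRealCLM.hasDerivAt (x := x)).mul_const Complex.I).cexp
    have hE' : ∀ x : ℝ, HasDerivAt (fun r : ℝ => Complex.exp (-(r * Complex.I)))
        (Complex.exp (-(x * Complex.I)) * -Complex.I) x := fun x => by
      simpa using ((Complex.ofRealCLM.hasDerivAt (x := x)).mul_const Complex.I).neg.cexp
    have hC : ∀ x : ℝ, HasDerivAt (fun r : ℝ => (Real.cos r : ℂ)) (-Real.sin x : ℝ) x :=
      fun x => (Real.hasDerivAt_cos x).ofReal_comp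
    have hS : ∀ x : ℝ, HasDerivAt (fun r : ℝ => (Real.sin r : ℂ)) (Real.cos x : ℝ) x :=
      fun x => (Real.hasDerivAt_sin x).ofReal_comp
    have h1 := exp_mul_exp_neg (u 1 * Complex.I)
    have h3 := exp_mul_exp_neg (u 3 * Complex.I)
    have hcs' : (s : ℂ) ^ 2 + (c : ℂ) ^ 2 = 1 := by exact_mod_cast hcs
    have hI := Complex.I_sq
    have g1 : Complex.exp (u 3 * Complex.I) * Complex.exp (-(u 1 * Complex.I))
        = p + q * Complex.I := by
      rw [← Complex.exp_add, hp, hq, Complex.ofReal_cos, Complex.ofReal_sin, ← Complex.exp_mul_I]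
      push_cast; congr 1; ring
    have g2 : Complex.exp (u 1 * Complex.I) * Complex.exp (-(u 3 * Complex.I))
        = p - q * Complex.I := by
      have := congrArg (starRingEnd ℂ) g1
      rw [map_mul, conj_exp_mul_I, ← conj_exp_mul_I (u 1), Complex.conj_conj] at this
      rw [mul_comm, this]
      simp [sub_eq_add_neg]
    intro k
    ext a b
    have key : HasDerivAt (fun r : ℝ => u2Cube R (Function.update u k r) a b)
        ((∑ l, ((!![1, 0, 0, 0; 0, -(c * s * p), c * s * q, -c ^ 2; 0, -q, -p, 0;
          0, -(c * s * p), c * s * q, s ^ 2] : Matrix (Fin 4) (Fin 4) ℝ) k l : ℂ) •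
            (u2Cube R u * minkowskiBasis l)) a b) (u k) := by
      fin_cases k <;> fin_cases a <;> fin_cases b <;>
        simp [u2Cube, minkowskiBasis, Fin.sum_univ_four,
          -Complex.ofReal_cos, -Complex.ofReal_sin]
      all_goals first
        | with_reducible refine (hasDerivAt_const _ _).congr_deriv ?_
        | with_reducible refine (((hE' _).const_mul _).mul_const _).congr_deriv ?_
        | with_reducible refine (((hE' _).const_mul _).mul_const _).fun_neg.congr_deriv ?_
        | with_reducible refine (((hE _).const_mul _).const_mul _).congr_deriv ?_
        | with_reducible refine (((hE' _).const_mul _).const_mul _).congr_deriv ?_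
        | with_reducible refine (((hE' _).const_mul _).const_mul _).fun_neg.congr_deriv ?_
        | with_reducible refine (((hC _).mul_const _).const_mul _).congr_deriv ?_
        | with_reducible refine (((hS _).mul_const _).const_mul _).congr_deriv ?_
        | with_reducible refine (((hS _).mul_const _).const_mul _).fun_neg.congr_deriv ?_
      all_goals try push_cast [-Complex.ofReal_cos, -Complex.ofReal_sin]
      all_goals
        rw [← hc] at *
        rw [← hs] at *
        clear hE hE' hC hS hc hs hp hq hu
        generalize Complex.exp (-(u 0 * Complex.I)) = y0 at *
        generalize Complex.exp (u 1 * Complex.I) = x1 at *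
        generalize Complex.exp (-(u 1 * Complex.I)) = y1 at *
        generalize Complex.exp (u 3 * Complex.I) = x3 at *
        generalize Complex.exp (-(u 3 * Complex.I)) = y3 at *
        have f1 : x1 * (p + q * Complex.I) = x3 := by linear_combination x3 * h1 - x1 * g1
        have f2 : x3 * (p - q * Complex.I) = x1 := by linear_combination x1 * h3 - x3 * g2
        have f3 : y1 * (p - q * Complex.I) = y3 := by linear_combination y3 * h1 - y1 * g2
        have f4 : y3 * (p + q * Complex.I) = y1 := by linear_combination y1 * h3 - y3 * g1
        grind
    exact key.deriv

end HC

namespace HC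

open MeasureTheory

/-! ### Integrals over boxes -/

/-! Write `I_k(p)` for the integral over `U(2)_R` of `p(Z - W) / N(Z - W)^k dZ⁴`, a linear
functional of the polynomial `p` (`u2Integral`). Everything follows from integration by parts on the
closed cycle `U(2)_R`.

Stokes: contracting `dZ⁴` with a constant vector `E_ij` gives a closed 3-form, so a holomorphic
`∂_ij`-derivative integrates to zero over a cycle. Applied to `p / N^k` this is `I_k(∂_q p) = k
I_{k+1}(p ∂_q N)` (`u2Integral_pderiv`). It is carried out on the parameter box by the divergence
theorem, for the vector field `u2Flux` that represents `E_ij` times the density; the boundary faces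
cancel or vanish (`boundary_term_eq_zero`).

Reproducing property: `N^2` has degree 4, the complex dimension, so integration by parts with the
Euler field gives `I_2(E p) = 0` for `E = ∑ X_q ∂_q` (`u2Integral_euler`). Hence `I_2` kills
monomials of positive degree, and `I_2(p) = p(0) I_2(1)`. The number `I_2(1)` does not change along
`τ W`, `0 ≤ τ ≤ 1`, as its `τ`-derivative is again the integral of a derivative
(`integral_inv_N_sub_sq`); at `W = 0` it is a product of elementary integrals, `-8 i π³`.

Conclusion: expand `F` around `W` as `G(Z - W)`. Then `Mx F(W)` is the constant term of `mxPoly G`,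
so `-8 i π³ Mx F(W) = I_2(mxPoly G)`. Two integrations by parts move the derivatives onto `N^{-2}`
and give `24 I_4(X⁺ G X⁺)` (`u2Integral_mxPoly`). Since `Z⁻¹ / N(Z) = Z⁺ / N(Z)²`, this is 24 times
the integral in question, and `24 / (-8 i π³) = 3 i / π³`. -/

theorem setIntegral_Icc_insertNth {n : ℕ} (k : Fin (n + 1)) {a b : Fin (n + 1) → ℝ}
    (hk : a k ≤ b k) {g : (Fin (n + 1) → ℝ) → ℂ} (hg : Continuous g) :
    ∫ x in Set.Icc a b, g x =
      ∫ y in Set.Icc (fun j => a (k.succAbove j)) (fun j => b (k.succAbove j)),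
        ∫ s in a k..b k, g (k.insertNth s y) := by
  have hmp := (volume_preserving_piFinSuccAbove (fun _ : Fin (n + 1) => ℝ) k).symm
  have hsymm : ∀ z : ℝ × (Fin n → ℝ),
      (MeasurableEquiv.piFinSuccAbove (fun _ : Fin (n + 1) => ℝ) k).symm z =
        k.insertNth z.1 z.2 := fun _ => rfl
  have hpre : (MeasurableEquiv.piFinSuccAbove (fun _ : Fin (n + 1) => ℝ) k).symm ⁻¹' Set.Icc a b =
      Set.Icc (a k) (b k) ×ˢ
        Set.Icc (fun j => a (k.succAbove j)) (fun j => b (k.succAbove j)) := by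
    ext ⟨s, y⟩
    rw [Set.mem_preimage, hsymm, Fin.insertNth_mem_Icc]
    rfl
  have hc : Continuous fun z : (Fin n → ℝ) × ℝ =>
      g ((MeasurableEquiv.piFinSuccAbove (fun _ : Fin (n + 1) => ℝ) k).symm z.swap) := by
    simp only [hsymm]
    fun_prop
  rw [← hmp.setIntegral_preimage_emb (MeasurableEquiv.measurableEmbedding _), hpre,
    Measure.volume_eq_prod, ← setIntegral_prod_swap, setIntegral_prod]
  · simp only [intervalIntegral.integral_of_le hk, integral_Icc_eq_integral_Ioc]
    rfl
  · exact hc.continuousOn.integrableOn_compact (isCompact_Icc.prod isCompact_Icc)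

/-- The integral of a function over a box is invariant under translation in a coordinate in which
the function is periodic with period the side of the box. -/
theorem setIntegral_Icc_update_add {n : ℕ} (k : Fin (n + 1)) {L : Fin (n + 1) → ℝ}
    (hk : 0 ≤ L k) {g : (Fin (n + 1) → ℝ) → ℂ} (hg : Continuous g)
    (hper : ∀ x, g (Function.update x k (x k + L k)) = g x) (r : ℝ) :
    ∫ x in Set.Icc 0 L, g (Function.update x k (x k + r)) = ∫ x in Set.Icc 0 L, g x := by
  rw [setIntegral_Icc_insertNth k hk hg, setIntegral_Icc_insertNth k hk (by fun_prop)]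
  congr 1
  ext y
  have hp : Function.Periodic (fun s => g (k.insertNth s y)) (L k) := fun s => by
    simpa using hper (k.insertNth s y)
  -- Only the integral over one period in the `k`-th coordinate matters, so Fubini reduces the claim
  -- to dimension one.
  have := hp.intervalIntegral_add_eq r 0
  simp only [Fin.insertNth_apply_same, Fin.update_insertNth, Pi.zero_apply]
  rw [intervalIntegral.integral_comp_add_right (fun s => g (k.insertNth s y))]
  simpa [add_comm] using this

theorem setIntegral_Icc_prod {n : ℕ} {L : Fin n → ℝ} (f : Fin n → ℝ → ℂ) (hL : 0 ≤ L) :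
    ∫ x in Set.Icc 0 L, ∏ i, f i (x i) = ∏ i, ∫ s in (0 : ℝ)..L i, f i s := by
  rw [← Set.pi_univ_Icc, volume_pi, Measure.restrict_pi_pi, integral_fintype_prod_eq_prod]
  refine Finset.prod_congr rfl fun i _ => ?_
  rw [intervalIntegral.integral_of_le (show 0 ≤ L i from hL i), integral_Icc_eq_integral_Ioc]
  rfl

/-! ### The coordinate frame of `u2Cube` -/

/-- The coordinate vector fields of the parametrization `u2Cube`. -/
noncomputable def u2Frame (R : ℝ) (u : Fin 4 → ℝ) : Fin 4 → HC :=
  let e := (R : ℂ) * Complex.exp (-(u 0 * Complex.I))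
  let c : ℂ := Real.cos (u 2)
  let s : ℂ := Real.sin (u 2)
  let x₁ := Complex.exp (u 1 * Complex.I)
  let y₁ := Complex.exp (-(u 1 * Complex.I))
  let x₃ := Complex.exp (u 3 * Complex.I)
  let y₃ := Complex.exp (-(u 3 * Complex.I))
  ![e • !![-Complex.I * c * x₁, -Complex.I * s * x₃; Complex.I * s * y₃, -Complex.I * c * y₁],
    e • !![Complex.I * c * x₁, 0; 0, -Complex.I * c * y₁],
    e • !![-s * x₁, c * x₃; -c * y₃, -s * y₁],
    e • !![0, Complex.I * s * x₃; Complex.I * s * y₃, 0]]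

/-- The density of the pull-back of `dZ⁴` under `u2Cube`. -/
noncomputable def u2Density (R : ℝ) (u : Fin 4 → ℝ) : ℂ :=
  -4 * Complex.I * (R * Complex.exp (-(u 0 * Complex.I))) ^ 4 *
    (Real.cos (u 2) * Real.sin (u 2))

/-- The components of the vector field in coordinates whose image under the differential of
`u2Cube` is `u2Density` times the matrix unit `E i j`. -/
noncomputable def u2Flux (R : ℝ) (i j : Fin 2) (k : Fin 4) (u : Fin 4 → ℝ) : ℂ :=
  let e := 2 * ((R : ℂ) * Complex.exp (-(u 0 * Complex.I))) ^ 3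
  let c : ℂ := Real.cos (u 2)
  let s : ℂ := Real.sin (u 2)
  let x₁ := Complex.exp (u 1 * Complex.I)
  let y₁ := Complex.exp (-(u 1 * Complex.I))
  let x₃ := Complex.exp (u 3 * Complex.I)
  let y₃ := Complex.exp (-(u 3 * Complex.I))
  (!![![e * (c ^ 2 * s) * y₁, e * -s * y₁, e * y₁ * (Complex.I * (c * s ^ 2)), 0],
      ![e * (c * s ^ 2) * y₃, 0, e * y₃ * (-Complex.I * (s * c ^ 2)), e * -c * y₃];
      ![e * -(c * s ^ 2) * x₃, 0, e * x₃ * (Complex.I * (s * c ^ 2)), e * -c * x₃],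
      ![e * (c ^ 2 * s) * x₁, e * s * x₁, e * x₁ * (Complex.I * (c * s ^ 2)), 0]] :
    Matrix (Fin 2) (Fin 2) (Fin 4 → ℂ)) i j k

theorem hasDerivAt_exp_mul_I (x : ℝ) : HasDerivAt (fun r : ℝ => Complex.exp (r * Complex.I))
    (Complex.exp (x * Complex.I) * Complex.I) x := by
  simpa using ((Complex.ofRealCLM.hasDerivAt (x := x)).mul_const Complex.I).cexp

theorem hasDerivAt_exp_neg_mul_I (x : ℝ) :
    HasDerivAt (fun r : ℝ => Complex.exp (-(r * Complex.I)))
      (Complex.exp (-(x * Complex.I)) * -Complex.I) x := by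
  simpa using ((Complex.ofRealCLM.hasDerivAt (x := x)).mul_const Complex.I).neg.cexp

theorem hasDerivAt_ofReal_cos (x : ℝ) :
    HasDerivAt (fun r : ℝ => (Real.cos r : ℂ)) (-(Real.sin x : ℂ)) x := by
  simpa using (Real.hasDerivAt_cos x).ofReal_comp

theorem hasDerivAt_ofReal_sin (x : ℝ) :
    HasDerivAt (fun r : ℝ => (Real.sin r : ℂ)) (Real.cos x) x :=
  (Real.hasDerivAt_sin x).ofReal_comp

theorem hasDerivAt_u2Cube (R : ℝ) (u : Fin 4 → ℝ) (k : Fin 4) (a b : Fin 2) :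
    HasDerivAt (fun r : ℝ => u2Cube R (Function.update u k r) a b) (u2Frame R u k a b) (u k) := by
  have hE := hasDerivAt_exp_mul_I
  have hE' := hasDerivAt_exp_neg_mul_I
  have hC := hasDerivAt_ofReal_cos
  have hS := hasDerivAt_ofReal_sin
  fin_cases k <;> fin_cases a <;> fin_cases b <;>
    simp [u2Cube, u2Frame, -Complex.ofReal_cos, -Complex.ofReal_sin]
  all_goals first
    | with_reducible refine (hasDerivAt_const _ _).congr_deriv ?_
    | with_reducible refine (((hE' _).const_mul _).mul_const _).congr_deriv ?_
    | with_reducible refine (((hE' _).const_mul _).mul_const _).fun_neg.congr_deriv ?_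
    | with_reducible refine (((hE _).const_mul _).const_mul _).congr_deriv ?_
    | with_reducible refine (((hE' _).const_mul _).const_mul _).congr_deriv ?_
    | with_reducible refine (((hE' _).const_mul _).const_mul _).fun_neg.congr_deriv ?_
    | with_reducible refine (((hC _).mul_const _).const_mul _).congr_deriv ?_
    | with_reducible refine (((hS _).mul_const _).const_mul _).congr_deriv ?_
    | with_reducible refine (((hS _).mul_const _).const_mul _).fun_neg.congr_deriv ?_
  all_goals try ring

theorem cubePartial_u2Cube (R : ℝ) (k : Fin 4) (u : Fin 4 → ℝ) :
    cubePartial (u2Cube R) k u = u2Frame R u k := by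
  ext a b
  exact (hasDerivAt_u2Cube R u k a b).deriv

theorem ofReal_sin_sq_add_cos_sq (x : ℝ) : (Real.sin x : ℂ) ^ 2 + (Real.cos x : ℂ) ^ 2 = 1 := by
  exact_mod_cast Real.sin_sq_add_cos_sq x

theorem dZ4_cubePartial_u2Cube (R : ℝ) (u : Fin 4 → ℝ) :
    dZ4 (fun k => cubePartial (u2Cube R) k u) = u2Density R u := by
  have h1 := exp_mul_exp_neg (u 1 * Complex.I)
  have h3 := exp_mul_exp_neg (u 3 * Complex.I)
  have hcs := ofReal_sin_sq_add_cos_sq (u 2)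
  have hI := Complex.I_sq
  simp only [cubePartial_u2Cube, dZ4, u2Frame, u2Density]
  simp [Matrix.det_succ_row_zero, Fin.sum_univ_succ, Fin.succAbove, -Complex.ofReal_cos,
    -Complex.ofReal_sin]
  generalize Complex.exp (-(u 0 * Complex.I)) = y0 at *
  generalize Complex.exp (u 1 * Complex.I) = x1 at *
  generalize Complex.exp (-(u 1 * Complex.I)) = y1 at *
  generalize Complex.exp (u 3 * Complex.I) = x3 at *
  generalize Complex.exp (-(u 3 * Complex.I)) = y3 at *
  generalize (Real.sin (u 2) : ℂ) = s at *
  generalize (Real.cos (u 2) : ℂ) = c at *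
  linear_combination 4 * Complex.I * (R * y0) ^ 4 * (c * s) * ((x1 * y1) * (x3 * y3) *
    (s ^ 2 + c ^ 2) * hI - (x3 * y3) * (s ^ 2 + c ^ 2) * h1 - (s ^ 2 + c ^ 2) * h3 - hcs)

/-- By Cramer's rule the density times the inverse of the frame is a matrix of cofactors, so the
flux components have no denominators and remain smooth on the faces where the frame degenerates. -/
theorem sum_u2Flux_mul_u2Frame (R : ℝ) (u : Fin 4 → ℝ) (i j a b : Fin 2) :
    ∑ k, u2Flux R i j k u * u2Frame R u k a b = Matrix.single i j (u2Density R u) a b := by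
  have h1 := exp_mul_exp_neg (u 1 * Complex.I)
  have h3 := exp_mul_exp_neg (u 3 * Complex.I)
  have hcs := ofReal_sin_sq_add_cos_sq (u 2)
  have hI := Complex.I_sq
  simp only [Fin.sum_univ_four, u2Density, u2Flux, u2Frame]
  generalize Complex.exp (-(u 0 * Complex.I)) = y0 at *
  generalize Complex.exp (u 1 * Complex.I) = x1 at *
  generalize Complex.exp (-(u 1 * Complex.I)) = y1 at *
  generalize Complex.exp (u 3 * Complex.I) = x3 at *
  generalize Complex.exp (-(u 3 * Complex.I)) = y3 at *
  generalize (Real.sin (u 2) : ℂ) = s at *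
  generalize (Real.cos (u 2) : ℂ) = c at *
  fin_cases i <;> fin_cases j <;> fin_cases a <;> fin_cases b <;> simp
  all_goals grind

/-- The partial derivatives `∂/∂uₖ` of the components `u2Flux R i j k`. -/
noncomputable def u2FluxDeriv (R : ℝ) (i j : Fin 2) (k : Fin 4) (u : Fin 4 → ℝ) : ℂ :=
  let e := 2 * ((R : ℂ) * Complex.exp (-(u 0 * Complex.I))) ^ 3
  let c : ℂ := Real.cos (u 2)
  let s : ℂ := Real.sin (u 2)
  let x₁ := Complex.exp (u 1 * Complex.I)
  let y₁ := Complex.exp (-(u 1 * Complex.I))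
  let x₃ := Complex.exp (u 3 * Complex.I)
  let y₃ := Complex.exp (-(u 3 * Complex.I))
  (e * Complex.I) *
  (!![![-3 * c ^ 2 * s * y₁, s * y₁, y₁ * (2 * c ^ 2 * s - s ^ 3), 0],
      ![-3 * c * s ^ 2 * y₃, 0, -y₃ * (c ^ 3 - 2 * c * s ^ 2), c * y₃];
      ![3 * c * s ^ 2 * x₃, 0, x₃ * (c ^ 3 - 2 * c * s ^ 2), -c * x₃],
      ![-3 * c ^ 2 * s * x₁, s * x₁, x₁ * (2 * c ^ 2 * s - s ^ 3), 0]] :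
    Matrix (Fin 2) (Fin 2) (Fin 4 → ℂ)) i j k

theorem hasDerivAt_u2Flux (R : ℝ) (u : Fin 4 → ℝ) (i j : Fin 2) (k : Fin 4) :
    HasDerivAt (fun r : ℝ => u2Flux R i j k (Function.update u k r)) (u2FluxDeriv R i j k u)
      (u k) := by
  have hE := hasDerivAt_exp_mul_I
  have hE' := hasDerivAt_exp_neg_mul_I
  have hC := hasDerivAt_ofReal_cos
  have hS := hasDerivAt_ofReal_sin
  -- The two shapes of the `η`-component; `h0` below serves the `t`-component, where the variable
  -- enters only through the cubed prefactor.
  have hCS : ∀ x : ℝ, HasDerivAt (fun r : ℝ => (Real.cos r : ℂ) * (Real.sin r : ℂ) ^ 2) _ x :=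
    fun x => (hC x).mul ((hS x).fun_pow 2)
  have hSC : ∀ x : ℝ, HasDerivAt (fun r : ℝ => (Real.sin r : ℂ) * (Real.cos r : ℂ) ^ 2) _ x :=
    fun x => (hS x).mul ((hC x).fun_pow 2)
  have h0 : ∀ x : ℝ, HasDerivAt
      (fun r : ℝ => 2 * ((R : ℂ) * Complex.exp (-(r * Complex.I))) ^ 3) _ x :=
    fun x => (((hE' x).const_mul (R : ℂ)).fun_pow 3).const_mul 2
  fin_cases i <;> fin_cases j <;> fin_cases k <;>
    simp [u2Flux, u2FluxDeriv, -Complex.ofReal_cos, -Complex.ofReal_sin, -neg_mul, -mul_neg]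
  all_goals first
    | with_reducible refine (hasDerivAt_const _ _).congr_deriv ?_
    | with_reducible refine (((h0 _).mul_const _).mul_const _).congr_deriv ?_
    | with_reducible refine ((hE _).const_mul _).congr_deriv ?_
    | with_reducible refine ((hE' _).const_mul _).congr_deriv ?_
    | with_reducible refine (((hCS _).const_mul _).const_mul _).congr_deriv ?_
    | with_reducible refine (((hSC _).const_mul _).const_mul _).congr_deriv ?_
  all_goals try (push_cast; ring)

/-- The coordinate form of the closedness of the contraction of `dZ⁴` with the constant vector
`E_ij`. -/
theorem sum_u2FluxDeriv (R : ℝ) (u : Fin 4 → ℝ) (i j : Fin 2) :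
    ∑ k, u2FluxDeriv R i j k u = 0 := by
  have hcs := ofReal_sin_sq_add_cos_sq (u 2)
  simp only [u2FluxDeriv, ← Finset.mul_sum]
  refine mul_eq_zero_of_right _ ?_
  simp only [Fin.sum_univ_four]
  generalize (Real.sin (u 2) : ℂ) = s at *
  generalize (Real.cos (u 2) : ℂ) = c at *
  fin_cases i <;> fin_cases j <;> simp <;> grind

/-! ### Nonvanishing of `N (Z - W)` -/

theorem star_ofQuaternion_mul_self (W : Quaternion ℝ) :
    star (ofQuaternion W) * ofQuaternion W = ((Quaternion.normSq W : ℝ) : ℂ) • (1 : HC) := by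
  have hI := Complex.I_sq
  ext a b
  fin_cases a <;> fin_cases b <;>
    simp [ofQuaternion, Matrix.mul_apply, Fin.sum_univ_two, Matrix.star_apply,
      Quaternion.normSq_def'] <;> grind

theorem star_u2Cube_mul_self (R : ℝ) (u : Fin 4 → ℝ) :
    star (u2Cube R u) * u2Cube R u = ((R ^ 2 : ℝ) : ℂ) • (1 : HC) := by
  have h0 := exp_mul_exp_neg (u 0 * Complex.I)
  have h1 := exp_mul_exp_neg (u 1 * Complex.I)
  have h3 := exp_mul_exp_neg (u 3 * Complex.I)
  have hcs := ofReal_sin_sq_add_cos_sq (u 2)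
  have c' : ∀ x : ℝ, (starRingEnd ℂ) (Complex.exp (-(x * Complex.I))) =
      Complex.exp (x * Complex.I) := fun x => by rw [← conj_exp_mul_I, Complex.conj_conj]
  ext a b
  fin_cases a <;> fin_cases b <;>
    simp [u2Cube, Matrix.mul_apply, Fin.sum_univ_two, Matrix.star_apply, conj_exp_mul_I, c',
      -Complex.ofReal_cos, -Complex.ofReal_sin] <;>
    generalize Complex.exp (u 0 * Complex.I) = x0 at * <;>
    generalize Complex.exp (-(u 0 * Complex.I)) = y0 at * <;>
    generalize Complex.exp (u 1 * Complex.I) = x1 at * <;>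
    generalize Complex.exp (-(u 1 * Complex.I)) = y1 at * <;>
    generalize Complex.exp (u 3 * Complex.I) = x3 at * <;>
    generalize Complex.exp (-(u 3 * Complex.I)) = y3 at * <;>
    generalize (Real.sin (u 2) : ℂ) = s at * <;>
    generalize (Real.cos (u 2) : ℂ) = c at * <;>
    grind

open scoped ComplexOrder in
-- Both matrices scale the Hermitian norm, by different factors: a kernel vector `v ≠ 0` of `Z - W`
-- would have `Zv = Wv`, hence `r |v|² = s |v|²`.
theorem N_sub_ne_zero {Z W : HC} {r s : ℝ} (hZ : star Z * Z = (r : ℂ) • (1 : HC))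
    (hW : star W * W = (s : ℂ) • (1 : HC)) (hsr : s < r) : N (Z - W) ≠ 0 := by
  intro h
  obtain ⟨v, hv, hv0⟩ := Matrix.exists_mulVec_eq_zero_iff.2 h
  rw [Matrix.sub_mulVec, sub_eq_zero] at hv0
  have key : ∀ {Y : HC} {q : ℝ}, star Y * Y = (q : ℂ) • (1 : HC) →
      dotProduct (star (Y.mulVec v)) (Y.mulVec v) = q * dotProduct (star v) v := by
    intro Y q hY
    rw [Matrix.star_mulVec, ← Matrix.dotProduct_mulVec, Matrix.mulVec_mulVec,
      ← Matrix.star_eq_conjTranspose, hY, Matrix.smul_mulVec, Matrix.one_mulVec,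
      dotProduct_smul, smul_eq_mul]
  have h1 := key hZ
  rw [hv0, key hW] at h1
  have hne : dotProduct (star v) v ≠ 0 := fun h0 => hv (dotProduct_star_self_eq_zero.1 h0)
  exact hsr.ne (by exact_mod_cast mul_right_cancel₀ hne h1)

theorem N_u2Cube_sub_ne_zero {R : ℝ} {W : Quaternion ℝ} (hW : Quaternion.normSq W < R ^ 2)
    (u : Fin 4 → ℝ) : N (u2Cube R u - ofQuaternion W) ≠ 0 :=
  N_sub_ne_zero (star_u2Cube_mul_self R u) (star_ofQuaternion_mul_self W) hW

/-! ### Calculus of polynomial functions -/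

/-- The chain rule is needed over two fields: over `ℂ` for `pd`, over `ℝ` for the box coordinates
and for the deformation parameter `τ`. -/
theorem _root_.MvPolynomial.hasDerivAt_eval {𝕜 σ : Type*} [NontriviallyNormedField 𝕜]
    [NormedAlgebra 𝕜 ℂ] [Fintype σ] {g : 𝕜 → σ → ℂ} {g' : σ → ℂ} {x : 𝕜}
    (hg : ∀ q, HasDerivAt (fun t => g t q) (g' q) x) (p : MvPolynomial σ ℂ) :
    HasDerivAt (fun t => MvPolynomial.eval (g t) p)
      (∑ q, g' q * MvPolynomial.eval (g x) (MvPolynomial.pderiv q p)) x := by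
  classical
  induction p using MvPolynomial.induction_on with
  | C a => simpa using hasDerivAt_const x a
  | add p q hp hq =>
    simp only [map_add, mul_add, Finset.sum_add_distrib]
    exact hp.add hq
  | mul_X p n hp =>
    simp only [map_mul, MvPolynomial.eval_X, Derivation.leibniz, smul_eq_mul, map_add,
      MvPolynomial.pderiv_X, mul_add, Finset.sum_add_distrib]
    refine (hp.mul (hg n)).congr_deriv ?_
    rw [add_comm, Finset.sum_mul]
    congr 1
    · rw [Finset.sum_eq_single n]
      · simp [mul_comm]
      · intro b _ hb
        simp [hb.symm]
      · simp
    · exact Finset.sum_congr rfl fun q _ => by ring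

theorem _root_.MvPolynomial.differentiable_eval {σ E : Type*} [NormedAddCommGroup E]
    [NormedSpace ℝ E] {g : E → σ → ℂ} (hg : ∀ q, Differentiable ℝ fun t => g t q)
    (p : MvPolynomial σ ℂ) : Differentiable ℝ fun t => MvPolynomial.eval (g t) p := by
  induction p using MvPolynomial.induction_on with
  | C a => simp
  | add p q hp hq => simpa using hp.fun_add hq
  | mul_X p n hp => simpa using hp.fun_mul (hg n)

/-- The entries of a matrix as a family indexed by pairs. -/
def entries (Z : HC) : Fin 2 × Fin 2 → ℂ := fun q => Z q.1 q.2

/-- The determinant as a polynomial. -/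
noncomputable def detPoly : MvPolynomial (Fin 2 × Fin 2) ℂ :=
  MvPolynomial.X (0, 0) * MvPolynomial.X (1, 1) - MvPolynomial.X (0, 1) * MvPolynomial.X (1, 0)

theorem eval_detPoly (Z : HC) : MvPolynomial.eval (entries Z) detPoly = N Z := by
  simp [detPoly, entries, N, Matrix.det_fin_two]

theorem pd_eval (i j : Fin 2) (p : MvPolynomial (Fin 2 × Fin 2) ℂ) (W Z : HC) :
    pd i j (fun Y => MvPolynomial.eval (entries (Y - W)) p) Z =
      MvPolynomial.eval (entries (Z - W)) (MvPolynomial.pderiv (i, j) p) := by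
  have hg : ∀ q : Fin 2 × Fin 2, HasDerivAt
      (fun t : ℂ => entries (Z + t • Matrix.single i j (1 : ℂ) - W) q)
      (Matrix.single i j (1 : ℂ) q.1 q.2) 0 := fun q => by
    have := ((hasDerivAt_id (0 : ℂ)).mul_const (Matrix.single i j (1 : ℂ) q.1 q.2)).const_add
      (Z q.1 q.2) |>.sub_const (W q.1 q.2)
    simpa [entries, -Matrix.smul_single] using this
  have h := (MvPolynomial.hasDerivAt_eval hg p).deriv
  rw [pd, h, Finset.sum_eq_single (i, j)]
  · simp
  · rintro ⟨a, b⟩ _ hb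
    have : ¬ (i = a ∧ j = b) := fun ⟨h1, h2⟩ => hb (by rw [h1, h2])
    simp [this]
  · simp

/-! ### Integrals of rational functions over `U(2)_R` -/

theorem differentiable_u2Cube (R : ℝ) (a b : Fin 2) :
    Differentiable ℝ fun u => u2Cube R u a b := by
  fin_cases a <;> fin_cases b <;> simp [u2Cube] <;> fun_prop

theorem differentiable_u2Flux (R : ℝ) (i j : Fin 2) (k : Fin 4) :
    Differentiable ℝ (u2Flux R i j k) := by
  unfold u2Flux
  fin_cases i <;> fin_cases j <;> fin_cases k <;> simp <;> fun_prop

theorem continuous_u2Density (R : ℝ) : Continuous (u2Density R) := by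
  unfold u2Density
  fun_prop

theorem differentiable_eval_u2Cube_sub (R : ℝ) (W : HC) (p : MvPolynomial (Fin 2 × Fin 2) ℂ) :
    Differentiable ℝ fun u => MvPolynomial.eval (entries (u2Cube R u - W)) p := by
  refine MvPolynomial.differentiable_eval (fun q => ?_) p
  simp only [entries, Matrix.sub_apply]
  exact (differentiable_u2Cube R q.1 q.2).fun_sub (differentiable_const _)

/-- The pull-back to parameter space of the function `p(Z - W) / N(Z - W)ᵏ`. -/
noncomputable def u2Rational (R : ℝ) (W : HC) (k : ℕ) (p : MvPolynomial (Fin 2 × Fin 2) ℂ)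
    (u : Fin 4 → ℝ) : ℂ :=
  MvPolynomial.eval (entries (u2Cube R u - W)) p * (N (u2Cube R u - W))⁻¹ ^ k

variable {R : ℝ} {W : HC}

theorem differentiable_u2Rational (hN : ∀ u, N (u2Cube R u - W) ≠ 0) (k : ℕ)
    (p : MvPolynomial (Fin 2 × Fin 2) ℂ) : Differentiable ℝ (u2Rational R W k p) := by
  refine (differentiable_eval_u2Cube_sub R W p).mul (Differentiable.fun_pow ?_ k)
  refine Differentiable.fun_inv ?_ hN
  simpa only [eval_detPoly] using differentiable_eval_u2Cube_sub R W detPoly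

theorem hasDerivAt_u2Rational (hN : ∀ u, N (u2Cube R u - W) ≠ 0) (k : ℕ)
    (p : MvPolynomial (Fin 2 × Fin 2) ℂ) (u : Fin 4 → ℝ) (l : Fin 4) :
    HasDerivAt (fun r => u2Rational R W k p (Function.update u l r))
      (∑ q : Fin 2 × Fin 2, u2Frame R u l q.1 q.2 *
        (u2Rational R W k (MvPolynomial.pderiv q p) u -
          k * u2Rational R W (k + 1) (p * MvPolynomial.pderiv q detPoly) u)) (u l) := by
  have hg : ∀ q : Fin 2 × Fin 2, HasDerivAt
      (fun r => entries (u2Cube R (Function.update u l r) - W) q) (u2Frame R u l q.1 q.2) (u l) :=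
    fun q => (hasDerivAt_u2Cube R u l q.1 q.2).sub_const (W q.1 q.2)
  have h1 := MvPolynomial.hasDerivAt_eval hg p
  have h2 := MvPolynomial.hasDerivAt_eval hg detPoly
  have h3 := h1.mul ((h2.fun_inv (by simpa [eval_detPoly] using hN u)).fun_pow k)
  simp only [eval_detPoly, Function.update_eq_self] at h3
  refine h3.congr_deriv ?_
  rw [Finset.sum_mul, neg_div, Finset.sum_div, ← Finset.sum_neg_distrib, Finset.mul_sum,
    Finset.mul_sum, ← Finset.sum_add_distrib]
  refine Finset.sum_congr rfl fun q _ => ?_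
  simp only [u2Rational, map_mul]
  -- The power rule produces the truncated exponent `k - 1`; for `k = 0` the factor `k` removes the
  -- term.
  rcases k with - | k
  · simp
  · simp only [Nat.add_sub_cancel]
    field_simp
    ring

/-! ### Identifications on the parameter box and boundary terms -/

theorem exp_add_two_pi_mul_I (x : ℝ) :
    Complex.exp (((x + 2 * Real.pi : ℝ) : ℂ) * Complex.I) = Complex.exp (x * Complex.I) := by
  push_cast
  rw [add_mul, Complex.exp_add, Complex.exp_two_pi_mul_I, mul_one]

theorem exp_add_pi_mul_I (x : ℝ) :
    Complex.exp (((x + Real.pi : ℝ) : ℂ) * Complex.I) = -Complex.exp (x * Complex.I) := by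
  push_cast
  rw [add_mul, Complex.exp_add, Complex.exp_pi_mul_I, mul_neg_one]

/-- Each matrix entry contains one exponential in `t` and one in `α` or `β`, so a common sign
cancels. The case `e = 1` expresses the periodicity in `α` and `β`, the case `e = -1` the gluing of
the faces `t = 0` and `t = π`. -/
theorem u2Cube_congr {u v : Fin 4 → ℝ} (e : ℂ)
    (h0 : Complex.exp (u 0 * Complex.I) = e * Complex.exp (v 0 * Complex.I))
    (h1 : Complex.exp (u 1 * Complex.I) = e * Complex.exp (v 1 * Complex.I)) (h2 : u 2 = v 2)
    (h3 : Complex.exp (u 3 * Complex.I) = e * Complex.exp (v 3 * Complex.I)) (he : e ^ 2 = 1) :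
    u2Cube R u = u2Cube R v := by
  have hi : e⁻¹ = e := inv_eq_of_mul_eq_one_left (by rw [← sq, he])
  ext a b
  fin_cases a <;> fin_cases b <;>
    simp [u2Cube, Complex.exp_neg, h0, h1, h2, h3, hi, -Complex.ofReal_cos, -Complex.ofReal_sin]
  all_goals grind

/-- The flux is cubic in `exp(-it)` and linear in one further exponential, an even total degree, so
it respects the same identifications. -/
theorem u2Flux_congr {u v : Fin 4 → ℝ} (e : ℂ)
    (h0 : Complex.exp (u 0 * Complex.I) = e * Complex.exp (v 0 * Complex.I))
    (h1 : Complex.exp (u 1 * Complex.I) = e * Complex.exp (v 1 * Complex.I)) (h2 : u 2 = v 2)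
    (h3 : Complex.exp (u 3 * Complex.I) = e * Complex.exp (v 3 * Complex.I)) (he : e ^ 2 = 1)
    (i j : Fin 2) (k : Fin 4) :
    u2Flux R i j k u = u2Flux R i j k v := by
  have hi : e⁻¹ = e := inv_eq_of_mul_eq_one_left (by rw [← sq, he])
  have he4 : e ^ 4 = 1 := by rw [show (4 : ℕ) = 2 * 2 from rfl, pow_mul, he, one_pow]
  fin_cases i <;> fin_cases j <;> fin_cases k <;>
    simp [u2Flux, Complex.exp_neg, h0, h1, h2, h3, hi, -Complex.ofReal_cos, -Complex.ofReal_sin]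
  all_goals try grind

/-- At these two faces a circle collapses under the parametrization, and no flux passes: the
`η`-component contains both `sin η` and `cos η`. -/
theorem u2Flux_two_eq_zero {u : Fin 4 → ℝ} (h : u 2 = 0 ∨ u 2 = Real.pi / 2) (i j : Fin 2) :
    u2Flux R i j 2 u = 0 := by
  rcases h with h | h <;> fin_cases i <;> fin_cases j <;>
    simp [u2Flux, h, -Complex.ofReal_cos, -Complex.ofReal_sin]

theorem u2Box_nonneg : 0 ≤ u2Box := by
  have := Real.pi_pos.le
  intro k
  fin_cases k <;> simp [u2Box] <;> positivity

/-- A function on parameter space factoring through `u2Cube`, times a component of `u2Flux`,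
contributes no boundary term to the divergence theorem on the parameter box. -/
theorem boundary_term_eq_zero {h : (Fin 4 → ℝ) → ℂ} (hc : Continuous h)
    (hφ : ∀ u v, u2Cube R u = u2Cube R v → h u = h v) (i j : Fin 2) (k : Fin 4) :
    (∫ x in Set.Icc ((0 : Fin 4 → ℝ) ∘ k.succAbove) (u2Box ∘ k.succAbove),
        h (k.insertNth (u2Box k) x) * u2Flux R i j k (k.insertNth (u2Box k) x)) -
      ∫ x in Set.Icc ((0 : Fin 4 → ℝ) ∘ k.succAbove) (u2Box ∘ k.succAbove),
        h (k.insertNth ((0 : Fin 4 → ℝ) k) x) *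
          u2Flux R i j k (k.insertNth ((0 : Fin 4 → ℝ) k) x) = 0 := by
  have hfc : Continuous fun u => h u * u2Flux R i j k u :=
    hc.mul (differentiable_u2Flux R i j k).continuous
  have hf : ∀ (u v : Fin 4 → ℝ) (e : ℂ),
      Complex.exp (u 0 * Complex.I) = e * Complex.exp (v 0 * Complex.I) →
      Complex.exp (u 1 * Complex.I) = e * Complex.exp (v 1 * Complex.I) → u 2 = v 2 →
      Complex.exp (u 3 * Complex.I) = e * Complex.exp (v 3 * Complex.I) → e ^ 2 = 1 →
      h u * u2Flux R i j k u = h v * u2Flux R i j k v := fun u v e h0 h1 h2 h3 he => by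
    rw [hφ u v (u2Cube_congr e h0 h1 h2 h3 he), u2Flux_congr e h0 h1 h2 h3 he]
  have e2 := exp_add_two_pi_mul_I
  have e1 := exp_add_pi_mul_I
  have e20 : Complex.exp (2 * Real.pi * Complex.I) = 1 := Complex.exp_two_pi_mul_I
  have i0 : ∀ (r : ℝ) (x : Fin 3 → ℝ), (Fin.insertNth 0 r x : Fin 4 → ℝ) =
      ![r, x 0, x 1, x 2] := fun r x => by ext l; fin_cases l <;> rfl
  have i1 : ∀ (r : ℝ) (x : Fin 3 → ℝ), (Fin.insertNth 1 r x : Fin 4 → ℝ) =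
      ![x 0, r, x 1, x 2] := fun r x => by ext l; fin_cases l <;> rfl
  have i2 : ∀ (r : ℝ) (x : Fin 3 → ℝ), (Fin.insertNth 2 r x : Fin 4 → ℝ) =
      ![x 0, x 1, r, x 2] := fun r x => by ext l; fin_cases l <;> rfl
  have i3 : ∀ (r : ℝ) (x : Fin 3 → ℝ), (Fin.insertNth 3 r x : Fin 4 → ℝ) =
      ![x 0, x 1, x 2, r] := fun r x => by ext l; fin_cases l <;> rfl
  have b0 : u2Box 0 = Real.pi := rfl
  have b1 : u2Box 1 = 2 * Real.pi := rfl
  have b2 : u2Box 2 = Real.pi / 2 := rfl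
  have b3 : u2Box 3 = 2 * Real.pi := rfl
  rw [sub_eq_zero]
  fin_cases k
  · change Continuous fun u => h u * u2Flux R i j 0 u at hfc
    set g : (Fin 3 → ℝ) → ℂ := fun x =>
      h (Fin.insertNth 0 0 x) * u2Flux R i j 0 (Fin.insertNth 0 0 x) with hg
    have hgc : Continuous g := by
      have : Continuous fun x : Fin 3 → ℝ => (Fin.insertNth 0 0 x : Fin 4 → ℝ) := by fun_prop
      exact hfc.comp this
    have hpi : (0 : ℝ) ≤ 2 * Real.pi := by positivity
    have p0 : ∀ x, g (Function.update x 0 (x 0 + 2 * Real.pi)) = g x := fun x => by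
      refine hf _ _ 1 ?_ ?_ ?_ ?_ (by simp) <;> rw [i0, i0] <;> simp
      simpa using e2 (x 0)
    have p2 : ∀ x, g (Function.update x 2 (x 2 + 2 * Real.pi)) = g x := fun x => by
      refine hf _ _ 1 ?_ ?_ ?_ ?_ (by simp) <;> rw [i0, i0] <;> simp
      simpa using e2 (x 2)
    -- Passing from `t = 0` to `t = π` changes the sign of `exp(it)`; shifting `α` and `β`
    -- (coordinates 0 and 2 of the face) by `π` compensates. The shifts are then removed by
    -- periodicity.
    have key : ∀ x : Fin 3 → ℝ, h (Fin.insertNth 0 (u2Box 0) x) *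
          u2Flux R i j 0 (Fin.insertNth 0 (u2Box 0) x) =
        g (Function.update (Function.update x 0 (x 0 + Real.pi)) 2
          ((Function.update x 0 (x 0 + Real.pi)) 2 + Real.pi)) := fun x => by
      refine hf _ _ (-1) ?_ ?_ ?_ ?_ (by simp) <;> rw [i0, i0] <;> simp [b0]
      · simpa using (congrArg Neg.neg (e1 (x 0))).symm
      · simpa using (congrArg Neg.neg (e1 (x 2))).symm
    calc _ = ∫ x in Set.Icc (0 : Fin 3 → ℝ) (u2Box ∘ Fin.succAbove 0),
          g (Function.update (Function.update x 0 (x 0 + Real.pi)) 2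
          ((Function.update x 0 (x 0 + Real.pi)) 2 + Real.pi)) :=
            integral_congr_ae (Filter.Eventually.of_forall key)
      _ = _ := by
        rw [setIntegral_Icc_update_add (n := 2) 0 (L := u2Box ∘ Fin.succAbove 0) hpi
          (g := fun x => g (Function.update x 2 (x 2 + Real.pi))) (by fun_prop) ?_ Real.pi,
          setIntegral_Icc_update_add (n := 2) 2 (L := u2Box ∘ Fin.succAbove 0) hpi hgc p2]
        · rfl
        · intro x
          have := p0 (Function.update x 2 (x 2 + Real.pi))
          rw [Function.update_comm (by decide)] at this
          exact this
  · refine integral_congr_ae (Filter.Eventually.of_forall fun x => ?_)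
    refine hf _ _ 1 ?_ ?_ ?_ ?_ (by simp) <;> simp [i1, b1, e20]
  -- The `η`-faces do not cancel each other; each integrand vanishes.
  · have z0 : ∀ a b c : ℝ, u2Flux R i j 2 ![a, b, 0, c] = 0 := fun a b c =>
      u2Flux_two_eq_zero (Or.inl rfl) i j
    have z1 : ∀ a b c : ℝ, u2Flux R i j 2 ![a, b, Real.pi / 2, c] = 0 := fun a b c =>
      u2Flux_two_eq_zero (Or.inr rfl) i j
    simp [i2, b2, z0, z1]
  · refine integral_congr_ae (Filter.Eventually.of_forall fun x => ?_)
    refine hf _ _ 1 ?_ ?_ ?_ ?_ (by simp) <;> simp [i3, b3, e20]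

/-! ### The integral as a functional of the numerator, and integration by parts -/

theorem continuous_u2Rational (hN : ∀ u, N (u2Cube R u - W) ≠ 0) (k : ℕ)
    (p : MvPolynomial (Fin 2 × Fin 2) ℂ) : Continuous (u2Rational R W k p) :=
  (differentiable_u2Rational hN k p).continuous

theorem integrableOn_u2Rational (hN : ∀ u, N (u2Cube R u - W) ≠ 0) (k : ℕ)
    (p : MvPolynomial (Fin 2 × Fin 2) ℂ) :
    IntegrableOn (fun u => u2Rational R W k p u * u2Density R u) (Set.Icc 0 u2Box) :=
  ((continuous_u2Rational hN k p).mul (continuous_u2Density R)).continuousOn.integrableOn_compact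
    isCompact_Icc

/-- The integral of `p(Z - W) / N(Z - W)ᵏ dZ⁴` over `U(2)_R`, as a linear functional of the
polynomial `p`. -/
noncomputable def u2Integral (hN : ∀ u, N (u2Cube R u - W) ≠ 0) (k : ℕ) :
    MvPolynomial (Fin 2 × Fin 2) ℂ →ₗ[ℂ] ℂ where
  toFun p := ∫ u in Set.Icc 0 u2Box, u2Rational R W k p u * u2Density R u
  map_add' p q := by
    rw [← integral_add (integrableOn_u2Rational hN k p) (integrableOn_u2Rational hN k q)]
    simp only [u2Rational, map_add, add_mul]
  map_smul' c p := by
    rw [RingHom.id_apply, smul_eq_mul, ← integral_const_mul]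
    simp only [u2Rational, MvPolynomial.smul_eval, mul_assoc]

theorem u2Integral_apply (hN : ∀ u, N (u2Cube R u - W) ≠ 0) (k : ℕ)
    (p : MvPolynomial (Fin 2 × Fin 2) ℂ) :
    u2Integral hN k p = ∫ u in Set.Icc 0 u2Box, u2Rational R W k p u * u2Density R u := rfl

theorem u2Integral_mul_detPoly (hN : ∀ u, N (u2Cube R u - W) ≠ 0) (k : ℕ)
    (p : MvPolynomial (Fin 2 × Fin 2) ℂ) :
    u2Integral hN (k + 1) (p * detPoly) = u2Integral hN k p := by
  simp only [u2Integral_apply]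
  congr 1
  ext u
  simp only [u2Rational, map_mul, eval_detPoly]
  rw [pow_succ']
  have := hN u
  field_simp

theorem fderiv_apply_single_of_hasDerivAt {n : ℕ} {f : (Fin n → ℝ) → ℂ} {u : Fin n → ℝ}
    {k : Fin n} {f' : ℂ} (hf : DifferentiableAt ℝ f u)
    (h : HasDerivAt (fun r => f (Function.update u k r)) f' (u k)) :
    fderiv ℝ f u (Pi.single k 1) = f' := by
  have h1 : HasFDerivAt f (fderiv ℝ f u) (Function.update u k (u k)) := by
    rw [Function.update_eq_self]
    exact hf.hasFDerivAt
  exact (h1.comp_hasDerivAt _ (hasDerivAt_update u k (u k))).unique h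

/-- The integral over `U(2)_R` of a partial derivative of `p(Z - W) / N(Z - W)ᵏ` vanishes. -/
theorem u2Integral_pderiv (hN : ∀ u, N (u2Cube R u - W) ≠ 0) (k : ℕ)
    (q : Fin 2 × Fin 2) (p : MvPolynomial (Fin 2 × Fin 2) ℂ) :
    u2Integral hN k (MvPolynomial.pderiv q p) =
      k * u2Integral hN (k + 1) (p * MvPolynomial.pderiv q detPoly) := by
  obtain ⟨i, j⟩ := q
  have hd := differentiable_u2Rational hN k p
  have hfd : ∀ l, Differentiable ℝ fun u => u2Rational R W k p u * u2Flux R i j l u := fun l =>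
    hd.fun_mul (differentiable_u2Flux R i j l)
  set D : Fin 2 × Fin 2 → (Fin 4 → ℝ) → ℂ := fun q u =>
    u2Rational R W k (MvPolynomial.pderiv q p) u -
      k * u2Rational R W (k + 1) (p * MvPolynomial.pderiv q detPoly) u with hD
  -- By the product rule the divergence has two parts: the flux is divergence free, and
  -- differentiating the rational function along it gives the derivative in direction `E_ij` times
  -- the density.
  have hdiv : ∀ u, ∑ l, fderiv ℝ (fun u => u2Rational R W k p u * u2Flux R i j l u) u
      (Pi.single l 1) = D (i, j) u * u2Density R u := fun u => by
    have h1 : ∀ l, fderiv ℝ (fun u => u2Rational R W k p u * u2Flux R i j l u) u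
        (Pi.single l 1) = ∑ q : Fin 2 × Fin 2, D q u * (u2Flux R i j l u * u2Frame R u l q.1 q.2) +
          u2Rational R W k p u * u2FluxDeriv R i j l u := fun l => by
      rw [fderiv_apply_single_of_hasDerivAt (hfd l u)
        ((hasDerivAt_u2Rational hN k p u l).fun_mul (hasDerivAt_u2Flux R u i j l)),
        Function.update_eq_self, Finset.sum_mul]
      congr 1
      exact Finset.sum_congr rfl fun q _ => by ring
    simp only [h1, Finset.sum_add_distrib, ← Finset.mul_sum, sum_u2FluxDeriv, mul_zero, add_zero]
    rw [Finset.sum_comm]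
    simp only [← Finset.mul_sum, sum_u2Flux_mul_u2Frame]
    rw [Finset.sum_eq_single (i, j)]
    · simp
    · rintro ⟨a, b⟩ _ hb
      have : ¬ (i = a ∧ j = b) := fun ⟨h1, h2⟩ => hb (by rw [h1, h2])
      simp [this]
    · simp
  have hsplit : ∀ u, D (i, j) u * u2Density R u =
      u2Rational R W k (MvPolynomial.pderiv (i, j) p) u * u2Density R u -
        k * (u2Rational R W (k + 1) (p * MvPolynomial.pderiv (i, j) detPoly) u *
          u2Density R u) := fun u => by
    simp only [hD]
    ring
  have hint := integrableOn_u2Rational hN k (MvPolynomial.pderiv (i, j) p)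
  have hint' := (integrableOn_u2Rational hN (k + 1)
    (p * MvPolynomial.pderiv (i, j) detPoly)).const_mul (k : ℂ)
  have h := integral_divergence_of_hasFDerivAt_off_countable' (0 : Fin 4 → ℝ) u2Box u2Box_nonneg
    (fun l u => u2Rational R W k p u * u2Flux R i j l u)
    (fun l => fderiv ℝ fun u => u2Rational R W k p u * u2Flux R i j l u) ∅ Set.countable_empty
    (fun l => (hfd l).continuous.continuousOn) (fun u _ l => (hfd l u).hasFDerivAt)
    (by
      simp only [hdiv, hsplit]
      exact hint.sub hint')
  simp only [hdiv, hsplit] at h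
  rw [integral_sub hint hint', integral_const_mul, Finset.sum_eq_zero, sub_eq_zero] at h
  · exact h
  · intro l _
    exact boundary_term_eq_zero hd.continuous (fun u v huv => by simp only [u2Rational, huv]) i j l

/-! ### The mean value property -/

theorem sum_X_mul_pderiv_detPoly :
    ∑ q, MvPolynomial.X q * MvPolynomial.pderiv q detPoly = 2 * detPoly := by
  simp [Fintype.sum_prod_type, detPoly, MvPolynomial.pderiv_X, Pi.single_apply]
  ring

/-- The exponent 2 is the critical one. Evaluating `∑ I_2(∂_q (X_q p))` by the Leibniz rule gives an
extra `4 I_2(p)`, one for each variable; integrating by parts gives `2 · 2 I_3(p N) = 4 I_2(p)`,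
because `N` has degree 2. -/
theorem u2Integral_euler (hN : ∀ u, N (u2Cube R u - W) ≠ 0)
    (p : MvPolynomial (Fin 2 × Fin 2) ℂ) :
    u2Integral hN 2 (∑ q, MvPolynomial.X q * MvPolynomial.pderiv q p) = 0 := by
  have h1 : ∑ q, u2Integral hN 2 (MvPolynomial.pderiv q (MvPolynomial.X q * p)) =
      4 * u2Integral hN 2 p := by
    simp only [u2Integral_pderiv, ← Finset.mul_sum, ← map_sum]
    have : ∑ q, MvPolynomial.X q * p * MvPolynomial.pderiv q detPoly =
        (2 : ℂ) • (p * detPoly) := by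
      rw [MvPolynomial.smul_eq_C_mul, map_ofNat, mul_left_comm, ← sum_X_mul_pderiv_detPoly,
        Finset.mul_sum]
      exact Finset.sum_congr rfl fun q _ => by ring
    rw [this, map_smul, u2Integral_mul_detPoly, smul_eq_mul]
    push_cast
    ring
  have h2 : ∑ q, u2Integral hN 2 (MvPolynomial.pderiv q (MvPolynomial.X q * p)) =
      u2Integral hN 2 (∑ q, MvPolynomial.X q * MvPolynomial.pderiv q p) +
        4 * u2Integral hN 2 p := by
    simp [Derivation.leibniz, Finset.sum_add_distrib]
  linear_combination h1 - h2

theorem u2Integral_two_eq (hN : ∀ u, N (u2Cube R u - W) ≠ 0)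
    (p : MvPolynomial (Fin 2 × Fin 2) ℂ) :
    u2Integral hN 2 p = MvPolynomial.eval 0 p * u2Integral hN 2 1 := by
  induction p using MvPolynomial.induction_on' with
  | add p q hp hq => rw [map_add, map_add, hp, hq, add_mul]
  | monomial m a =>
    by_cases hm : m = 0
    · subst hm
      have : MvPolynomial.monomial (0 : Fin 2 × Fin 2 →₀ ℕ) a = a • 1 := by
        rw [MvPolynomial.smul_eq_C_mul, mul_one]; rfl
      rw [this, map_smul]
      simp
    · have h1 := u2Integral_euler hN (MvPolynomial.monomial m a)
      -- Monomials are eigenvectors of the Euler operator, with the degree as eigenvalue.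
      rw [(MvPolynomial.isHomogeneous_monomial a rfl).sum_X_mul_pderiv, map_nsmul] at h1
      have hdeg : m.degree ≠ 0 := (Finsupp.degree_eq_zero_iff m).not.2 hm
      have h2 : u2Integral hN 2 (MvPolynomial.monomial m a) = 0 := by
        simpa [hdeg] using h1
      have h3 : MvPolynomial.eval 0 (MvPolynomial.monomial m a) = 0 := by
        obtain ⟨q, hq⟩ := Finsupp.ne_iff.1 hm
        rw [MvPolynomial.eval_monomial, Finsupp.prod,
          Finset.prod_eq_zero (i := q) (by simpa using hq)]
        · simp
        · simpa using hq
      rw [h2, h3, zero_mul]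

theorem N_u2Cube (u : Fin 4 → ℝ) :
    N (u2Cube R u) = (R * Complex.exp (-(u 0 * Complex.I))) ^ 2 := by
  have h1 := exp_mul_exp_neg (u 1 * Complex.I)
  have h3 := exp_mul_exp_neg (u 3 * Complex.I)
  have hcs := ofReal_sin_sq_add_cos_sq (u 2)
  rw [N, u2Cube, Matrix.det_smul, Matrix.det_fin_two_of, Fintype.card_fin]
  linear_combination ((R : ℂ) * Complex.exp (-(u 0 * Complex.I))) ^ 2 *
    (Real.cos (u 2) ^ 2 * h1 + Real.sin (u 2) ^ 2 * h3 + hcs)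

theorem integral_inv_N_sq (hR : R ≠ 0) :
    ∫ u in Set.Icc 0 u2Box, (N (u2Cube R u))⁻¹ ^ 2 * u2Density R u =
      -8 * Complex.I * (Real.pi : ℂ) ^ 3 := by
  have hR' : (R : ℂ) ≠ 0 := by exact_mod_cast hR
  set f : Fin 4 → ℝ → ℂ :=
    ![fun _ => -4 * Complex.I, fun _ => 1, fun x => ((Real.sin x * Real.cos x : ℝ) : ℂ),
      fun _ => 1] with hf
  -- The fourth powers of `R exp(-it)` cancel, so the value is `-4i · π · 2π · 1/2 · 2π`.
  have h : ∀ u : Fin 4 → ℝ, (N (u2Cube R u))⁻¹ ^ 2 * u2Density R u = ∏ l, f l (u l) := fun u => by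
    have := Complex.exp_ne_zero (-(u 0 * Complex.I))
    rw [N_u2Cube, u2Density, Fin.prod_univ_four]
    simp only [hf, Matrix.cons_val]
    push_cast
    field_simp
  simp only [h]
  rw [setIntegral_Icc_prod f u2Box_nonneg, Fin.prod_univ_four]
  simp only [hf, Matrix.cons_val, u2Box, intervalIntegral.integral_ofReal,
    integral_sin_mul_cos₁, intervalIntegral.integral_const]
  simp
  ring

/-- Moving the pole along `τ W` never meets the cycle, and the `τ`-derivative of `N(Z - τW)^{-2}` is
minus its `Z`-derivative in direction `W`, whose integral is zero. The fundamental theorem of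
calculus and Fubini replace differentiation under the integral sign. -/
theorem integral_inv_N_sub_sq (hN : ∀ τ ∈ Set.Icc (0 : ℝ) 1, ∀ u, N (u2Cube R u - τ • W) ≠ 0) :
    ∫ u in Set.Icc 0 u2Box, (N (u2Cube R u - W))⁻¹ ^ 2 * u2Density R u =
      ∫ u in Set.Icc 0 u2Box, (N (u2Cube R u))⁻¹ ^ 2 * u2Density R u := by
  set d : ℝ → (Fin 4 → ℝ) → ℂ := fun τ u =>
    ∑ q : Fin 2 × Fin 2, (2 * W q.1 q.2) *
      (u2Rational R (τ • W) 3 (1 * MvPolynomial.pderiv q detPoly) u * u2Density R u) with hd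
  have hzero : ∀ τ ∈ Set.Icc (0 : ℝ) 1, ∫ u in Set.Icc 0 u2Box, d τ u = 0 := fun τ hτ => by
    simp only [hd]
    rw [integral_finsetSum _ fun q _ => (integrableOn_u2Rational (hN τ hτ) 3 _).const_mul _]
    refine Finset.sum_eq_zero fun q _ => ?_
    rw [integral_const_mul, ← u2Integral_apply (hN τ hτ)]
    -- With numerator 1 the left side of the integration by parts vanishes; the factor `1 *` in `d`
    -- matches this instance.
    have := u2Integral_pderiv (hN τ hτ) 2 q 1
    rw [Derivation.map_one_eq_zero, map_zero] at this
    push_cast at this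
    linear_combination -(W q.1 q.2) * this
  have hcont_eval : ∀ p : MvPolynomial (Fin 2 × Fin 2) ℂ, Continuous fun z : ℝ × (Fin 4 → ℝ) =>
      MvPolynomial.eval (entries (u2Cube R z.2 - z.1 • W)) p := fun p => by
    refine (MvPolynomial.continuous_eval p).comp (continuous_pi fun q => ?_)
    have := (differentiable_u2Cube R q.1 q.2).continuous
    simp only [entries, Matrix.sub_apply, Matrix.smul_apply]
    fun_prop
  have hcont_rat : ∀ p, ContinuousOn (fun z : ℝ × (Fin 4 → ℝ) => u2Rational R (z.1 • W) 3 p z.2)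
      (Set.Icc 0 1 ×ˢ Set.univ) := fun p => by
    refine (hcont_eval p).continuousOn.mul (ContinuousOn.pow (ContinuousOn.inv₀ ?_ ?_) 3)
    · simpa only [eval_detPoly] using (hcont_eval detPoly).continuousOn
    · exact fun z hz => hN z.1 hz.1 z.2
  have hcont : ContinuousOn (Function.uncurry d) (Set.Icc 0 1 ×ˢ Set.univ) := by
    refine continuousOn_finsetSum _ fun q _ => ContinuousOn.mul continuousOn_const ?_
    exact (hcont_rat _).mul ((continuous_u2Density R).comp continuous_snd).continuousOn
  have hderiv : ∀ u, ∀ τ ∈ Set.Icc (0 : ℝ) 1,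
      HasDerivAt (fun τ : ℝ => (N (u2Cube R u - τ • W))⁻¹ ^ 2 * u2Density R u) (d τ u) τ := by
    intro u τ hτ
    have hg : ∀ q : Fin 2 × Fin 2, HasDerivAt
        (fun t : ℝ => entries (u2Cube R u - t • W) q) (-W q.1 q.2) τ := fun q => by
      have := ((hasDerivAt_id τ).smul_const (W q.1 q.2)).const_sub (u2Cube R u q.1 q.2)
      simpa [entries] using this
    have h1 := MvPolynomial.hasDerivAt_eval hg detPoly
    have h2 := ((h1.fun_inv (by simpa only [eval_detPoly] using hN τ hτ u)).fun_pow 2).mul_const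
      (u2Density R u)
    simp only [eval_detPoly] at h2
    refine h2.congr_deriv ?_
    simp only [hd, u2Rational, one_mul]
    rw [neg_div, Finset.sum_div, ← Finset.sum_neg_distrib, Finset.mul_sum, Finset.sum_mul]
    refine Finset.sum_congr rfl fun q _ => ?_
    have := hN τ hτ u
    rw [show 2 - 1 = 1 from rfl]
    push_cast
    field_simp
  have hftc : ∀ u, ∫ τ in (0 : ℝ)..1, d τ u =
      (N (u2Cube R u - W))⁻¹ ^ 2 * u2Density R u - (N (u2Cube R u))⁻¹ ^ 2 * u2Density R u := by
    intro u
    rw [intervalIntegral.integral_eq_sub_of_hasDerivAt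
      (f := fun τ : ℝ => (N (u2Cube R u - τ • W))⁻¹ ^ 2 * u2Density R u)]
    · simp
    · rw [Set.uIcc_of_le zero_le_one]
      exact hderiv u
    · refine ContinuousOn.intervalIntegrable ?_
      rw [Set.uIcc_of_le zero_le_one]
      exact hcont.comp (f := fun τ : ℝ => (τ, u)) (by fun_prop) fun τ hτ => ⟨hτ, trivial⟩
  have hswap : ∫ τ in (0 : ℝ)..1, ∫ u in Set.Icc 0 u2Box, d τ u =
      ∫ u in Set.Icc 0 u2Box, ∫ τ in (0 : ℝ)..1, d τ u := by
    refine intervalIntegral_integral_swap ?_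
    rw [Set.uIoc_of_le zero_le_one, Measure.prod_restrict]
    exact ((hcont.mono (Set.prod_mono_right (Set.subset_univ _))).integrableOn_compact
      (isCompact_Icc.prod isCompact_Icc)).mono_set (Set.prod_mono_left Set.Ioc_subset_Icc_self)
  have hint : ∀ V : HC, (∀ u, N (u2Cube R u - V) ≠ 0) →
      IntegrableOn (fun u => (N (u2Cube R u - V))⁻¹ ^ 2 * u2Density R u) (Set.Icc 0 u2Box) :=
    fun V hV => by simpa [u2Rational] using integrableOn_u2Rational hV 2 1
  have hint1 := hint W (by simpa using hN 1 (by simp))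
  have hint0 := hint 0 (by simpa using hN 0 (by simp))
  simp only [sub_zero] at hint0
  simp only [hftc] at hswap
  rw [integral_sub hint1 hint0, intervalIntegral.integral_congr (g := fun _ => (0 : ℂ)),
    intervalIntegral.integral_zero] at hswap
  · exact sub_eq_zero.1 hswap.symm
  · intro τ hτ
    rw [Set.uIcc_of_le zero_le_one] at hτ
    exact hzero τ hτ

theorem ofQuaternion_smul (τ : ℝ) (W : Quaternion ℝ) :
    ofQuaternion (τ • W) = τ • ofQuaternion W := by
  ext a b
  fin_cases a <;> fin_cases b <;> simp [ofQuaternion] <;> ring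

/-- The reproducing property of the kernel `N(Z - W)⁻²` for polynomials in `Z - W`. -/
theorem u2Integral_two_ofQuaternion (hR : 0 < R) {W : Quaternion ℝ}
    (hW : Quaternion.normSq W < R ^ 2) (p : MvPolynomial (Fin 2 × Fin 2) ℂ) :
    u2Integral (N_u2Cube_sub_ne_zero hW) 2 p =
      -8 * Complex.I * (Real.pi : ℂ) ^ 3 * MvPolynomial.eval 0 p := by
  have hN : ∀ τ ∈ Set.Icc (0 : ℝ) 1, ∀ u, N (u2Cube R u - τ • ofQuaternion W) ≠ 0 := by
    intro τ hτ u
    rw [← ofQuaternion_smul]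
    refine N_u2Cube_sub_ne_zero ?_ u
    rw [Quaternion.normSq_smul]
    have h0 : 0 ≤ Quaternion.normSq W := Quaternion.normSq_nonneg
    have h1 : τ ^ 2 ≤ 1 := pow_le_one₀ hτ.1 hτ.2
    nlinarith
  rw [u2Integral_two_eq, mul_comm]
  congr 1
  rw [u2Integral_apply, ← integral_inv_N_sq hR.ne', ← integral_inv_N_sub_sq hN]
  simp [u2Rational]

/-! ### The operator `Mx` on polynomials -/

/-- The function `Z ↦ G(Z - W)` of a matrix of polynomials `G`. -/
noncomputable def shiftedPolyFun (W : HC)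
    (G : Matrix (Fin 2) (Fin 2) (MvPolynomial (Fin 2 × Fin 2) ℂ)) (Z : HC) : HC :=
  Matrix.of fun a b => MvPolynomial.eval (entries (Z - W)) (G a b)

/-- Quaternionic conjugation of a matrix of polynomials. -/
noncomputable def conjPoly (G : Matrix (Fin 2) (Fin 2) (MvPolynomial (Fin 2 × Fin 2) ℂ)) :
    Matrix (Fin 2) (Fin 2) (MvPolynomial (Fin 2 × Fin 2) ℂ) :=
  !![G 1 1, -G 0 1; -G 1 0, G 0 0]

/-- The operator `Mx` on matrices of polynomials. -/
noncomputable def mxPoly (G : Matrix (Fin 2) (Fin 2) (MvPolynomial (Fin 2 × Fin 2) ℂ)) :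
    Matrix (Fin 2) (Fin 2) (MvPolynomial (Fin 2 × Fin 2) ℂ) :=
  Matrix.of fun a b =>
    ∑ d, (2 : ℂ) • MvPolynomial.pderiv (b, d)
        (∑ c, (2 : ℂ) • MvPolynomial.pderiv (c, a) (G c d)) -
      (4 : ℂ) • (MvPolynomial.pderiv (0, 0) (MvPolynomial.pderiv (1, 1) (conjPoly G a b)) -
        MvPolynomial.pderiv (0, 1) (MvPolynomial.pderiv (1, 0) (conjPoly G a b)))

theorem conj_shiftedPolyFun (G : Matrix (Fin 2) (Fin 2) (MvPolynomial (Fin 2 × Fin 2) ℂ)) :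
    (fun Z => conj (shiftedPolyFun W G Z)) = shiftedPolyFun W (conjPoly G) := by
  ext Z a b
  fin_cases a <;> fin_cases b <;> simp [conj, shiftedPolyFun, conjPoly]

theorem nablaLeft_shiftedPolyFun
    (G : Matrix (Fin 2) (Fin 2) (MvPolynomial (Fin 2 × Fin 2) ℂ)) :
    nablaLeft (shiftedPolyFun W G) = shiftedPolyFun W
      (Matrix.of fun a b => ∑ c, (2 : ℂ) • MvPolynomial.pderiv (c, a) (G c b)) := by
  ext Z a b
  simp [nablaLeft, shiftedPolyFun, pd_eval]

theorem nablaRight_shiftedPolyFun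
    (G : Matrix (Fin 2) (Fin 2) (MvPolynomial (Fin 2 × Fin 2) ℂ)) :
    nablaRight (shiftedPolyFun W G) = shiftedPolyFun W
      (Matrix.of fun a b => ∑ c, (2 : ℂ) • MvPolynomial.pderiv (b, c) (G a c)) := by
  ext Z a b
  simp [nablaRight, shiftedPolyFun, pd_eval]

theorem Mx_shiftedPolyFun (G : Matrix (Fin 2) (Fin 2) (MvPolynomial (Fin 2 × Fin 2) ℂ)) :
    Mx (shiftedPolyFun W G) = shiftedPolyFun W (mxPoly G) := by
  have hpd : ∀ i j p, pd i j (fun Y => MvPolynomial.eval (entries (Y - W)) p) =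
      fun Z => MvPolynomial.eval (entries (Z - W)) (MvPolynomial.pderiv (i, j) p) :=
    fun i j p => funext (pd_eval i j p W)
  ext Z a b
  rw [Mx, nablaLeft_shiftedPolyFun, nablaRight_shiftedPolyFun, conj_shiftedPolyFun]
  simp only [box, shiftedPolyFun, mxPoly, hpd, Matrix.sub_apply, Matrix.of_apply, map_sub,
    MvPolynomial.smul_eval]

/-- Re-expansion around `W`: substitute `X + W` for `X`. The value at `W` then becomes a constant
term. -/
theorem exists_polyFun_eq_shiftedPolyFun (W : HC)
    (F : Matrix (Fin 2) (Fin 2) (MvPolynomial (Fin 2 × Fin 2) ℂ)) :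
    ∃ G, polyFun F = shiftedPolyFun W G := by
  set f : Fin 2 × Fin 2 → MvPolynomial (Fin 2 × Fin 2) ℂ :=
    fun q => MvPolynomial.X q + MvPolynomial.C (W q.1 q.2) with hf
  refine ⟨F.map (MvPolynomial.bind₁ f), ?_⟩
  ext Z a b
  refine Eq.trans ?_
    (MvPolynomial.eval₂Hom_bind₁ (RingHom.id ℂ) (entries (Z - W)) f (F a b)).symm
  refine congrArg (fun g => MvPolynomial.eval₂Hom (RingHom.id ℂ) g (F a b)) ?_
  ext q
  simp [hf, entries]

/-! ### Moving the second-order operator onto the kernel -/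

theorem u2Integral_pderiv_pderiv (hN : ∀ u, N (u2Cube R u - W) ≠ 0) (q r : Fin 2 × Fin 2)
    (p : MvPolynomial (Fin 2 × Fin 2) ℂ) :
    u2Integral hN 2 (MvPolynomial.pderiv q (MvPolynomial.pderiv r p)) =
      u2Integral hN 4 (p * (6 * MvPolynomial.pderiv q detPoly * MvPolynomial.pderiv r detPoly -
        2 * MvPolynomial.pderiv r (MvPolynomial.pderiv q detPoly) * detPoly)) := by
  -- The first step has factor 2 and the second factor 3, whence `6 = 2 · 3`. The second is applied
  -- to `p ∂_q N`, and its Leibniz term `p ∂_r ∂_q N` is multiplied by `N` to bring it to exponent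
  -- 4.
  have h1 := u2Integral_pderiv hN 2 q (MvPolynomial.pderiv r p)
  have h2 := u2Integral_pderiv hN 3 r (p * MvPolynomial.pderiv q detPoly)
  rw [Derivation.leibniz, map_add, smul_eq_mul, smul_eq_mul,
    ← u2Integral_mul_detPoly hN 3 (p * _)] at h2
  have h3 : p * (6 * MvPolynomial.pderiv q detPoly * MvPolynomial.pderiv r detPoly -
        2 * MvPolynomial.pderiv r (MvPolynomial.pderiv q detPoly) * detPoly) =
      (6 : ℂ) • (p * MvPolynomial.pderiv q detPoly * MvPolynomial.pderiv r detPoly) -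
        (2 : ℂ) • (p * MvPolynomial.pderiv r (MvPolynomial.pderiv q detPoly) * detPoly) := by
    simp only [MvPolynomial.smul_eq_C_mul, map_ofNat]
    ring
  rw [h3, map_sub, map_smul, map_smul, smul_eq_mul, smul_eq_mul, h1,
    mul_comm (MvPolynomial.pderiv r p)]
  push_cast at h2 ⊢
  linear_combination 2 * h2

/-- Since `∇N = 2 Z⁺`, the products of first derivatives in the `∇ ∇` term give `6 · 4 Z⁺ G Z⁺`. Its
second derivatives of `N` contribute `8 N G⁺`, and this is exactly what the correction `-□G⁺`
cancels, as `□(N^{-2}) = 8 N^{-3}`. -/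
theorem u2Integral_mxPoly (hN : ∀ u, N (u2Cube R u - W) ≠ 0)
    (G : Matrix (Fin 2) (Fin 2) (MvPolynomial (Fin 2 × Fin 2) ℂ)) (a b : Fin 2) :
    u2Integral hN 2 (mxPoly G a b) =
      24 * u2Integral hN 4
        ((conjPoly (Matrix.of fun i j => MvPolynomial.X (i, j)) * G *
          conjPoly (Matrix.of fun i j => MvPolynomial.X (i, j))) a b) := by
  rw [← smul_eq_mul, ← map_smul]
  simp only [mxPoly, Matrix.of_apply, map_sub, map_sum, map_smul, Derivation.map_smul,
    u2Integral_pderiv_pderiv]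
  simp only [← map_sub, ← map_sum, ← map_smul]
  congr 1
  simp only [MvPolynomial.smul_eq_C_mul, map_ofNat, Matrix.mul_apply, Fin.sum_univ_two]
  fin_cases a <;> fin_cases b <;>
    simp [conjPoly, detPoly, MvPolynomial.pderiv_X] <;> ring

theorem fueterKernel_eq (Z : HC) : fueterKernel Z = (N Z)⁻¹ ^ 2 • conj Z := by
  rw [fueterKernel, Matrix.inv_def, Ring.inverse_eq_inv', smul_smul, sq, Matrix.adjugate_fin_two]
  rfl

theorem integralU2R_fueterKernel (hN : ∀ u, N (u2Cube R u - W) ≠ 0)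
    (G : Matrix (Fin 2) (Fin 2) (MvPolynomial (Fin 2 × Fin 2) ℂ)) (a b : Fin 2) :
    integralU2R R (fun Z => fueterKernel (Z - W) * shiftedPolyFun W G Z * fueterKernel (Z - W))
        a b =
      u2Integral hN 4
        ((conjPoly (Matrix.of fun i j => MvPolynomial.X (i, j)) * G *
          conjPoly (Matrix.of fun i j => MvPolynomial.X (i, j))) a b) := by
  simp only [integralU2R, cubeIntegral, Matrix.of_apply, u2Integral_apply,
    dZ4_cubePartial_u2Cube]
  congr 1
  ext u
  congr 1
  rw [fueterKernel_eq, u2Rational]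
  simp only [Matrix.smul_mul, Matrix.mul_smul, Matrix.smul_apply, smul_eq_mul]
  -- Each kernel contributes `N^{-2}`, together the exponent 4.
  rw [← mul_assoc, ← pow_add, mul_comm]
  congr 1
  simp only [Matrix.mul_apply, Fin.sum_univ_two]
  fin_cases a <;> fin_cases b <;> simp [conj, conjPoly, shiftedPolyFun, entries] <;> ring

end HC

theorem mainTheorem1
    (F : Matrix (Fin 2) (Fin 2) (MvPolynomial (Fin 2 × Fin 2) ℂ))
    (R : ℝ) (hR : 0 < R) (W : Quaternion ℝ) (hW : Quaternion.normSq W < R ^ 2) :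
    (∀ Z ∈ HC.U2R R, HC.N (Z - HC.ofQuaternion W) ≠ 0) ∧
    HC.Mx (HC.polyFun F) (HC.ofQuaternion W) =
      (3 * Complex.I / (Real.pi : ℂ) ^ 3) •
        HC.integralU2R R (fun Z =>
          HC.fueterKernel (Z - HC.ofQuaternion W) * HC.polyFun F Z *
            HC.fueterKernel (Z - HC.ofQuaternion W)) := by
  constructor
  · intro Z hZ
    rw [← HC.u2Cube_image] at hZ
    obtain ⟨u, -, rfl⟩ := hZ
    exact HC.N_u2Cube_sub_ne_zero hW u
  · obtain ⟨G, hG⟩ := HC.exists_polyFun_eq_shiftedPolyFun (HC.ofQuaternion W) F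
    rw [hG, HC.Mx_shiftedPolyFun]
    ext a b
    have hN := HC.N_u2Cube_sub_ne_zero hW
    have hpi : (Real.pi : ℂ) ≠ 0 := by exact_mod_cast Real.pi_ne_zero
    have h1 := HC.u2Integral_mxPoly hN G a b
    rw [HC.u2Integral_two_ofQuaternion hR hW] at h1
    rw [Matrix.smul_apply, HC.integralU2R_fueterKernel hN, smul_eq_mul]
    have h0 : HC.entries (HC.ofQuaternion W - HC.ofQuaternion W) = 0 := by
      ext q
      simp [HC.entries]
    simp only [HC.shiftedPolyFun, Matrix.of_apply, h0]
    field_simp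
    -- `h1` reads `-8 i π³ · (Mx F)(W) = 24 I_4`; multiplying by `i / 8` and using `i² = -1`
    -- isolates `π³ (Mx F)(W) = 3 i I_4`.
    linear_combination (Complex.I / 8) * h1 +
      (Real.pi : ℂ) ^ 3 * MvPolynomial.eval 0 (HC.mxPoly G a b) * Complex.I_sq
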